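/- Let $n\ge 2$ be even and let $D_n=\langle \sigma,\tau \mid \sigma^n=\tau^2=e,\ \tau\sigma=\sigma^{n-1}\tau\rangle$ be the dihedral group of order $2n$; put $\omega=e^{2\pi i/n}$. For a finite group $G$ let $D(G)$ be its quantum double over $\mathbb C$: the $\mathbb C$-algebra with basis $\{g h^*: g,h\in G\}$ whose product is determined by the product of $G$ and by $g^*h^*=\delta(g,h)h^*$, $h^*g=g\,(g^{-1}hg)^*$ (where $g=\sum_{h} g h^*$, $h^*=e\,h^*$, and $1=\sum_h h^*$). **(1) Conjugacy classes.** The conjugacy classes $C$ of $D_n$, each listed once, with representatives $g_C\in C$, centralisers $Z(g_C)$ and elements $\alpha_s$ ($s\in C$) satisfying $s=\alpha_s g_C\alpha_s^{-1}$ and $\alpha_{g_C}=e$, are: - $\{e\}$: $g_C=e$, $Z=D_n$, $\alpha_e=e$; - $\{\sigma^{n/2}\}$: $g_C=\sigma^{n/2}$, $Z=D_n$, $\alpha_{\sigma^{n/2}}=e$; - $\{\sigma^k,\sigma^{-k}\}$, for each $1\le k<n/2$: $g_C=\sigma^k$, $Z=\{\sigma^i: 0\le i<n\}$, $\alpha_{\sigma^k}=e$,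 $\alpha_{\sigma^{-k}}=\tau$; - $\{\sigma^{2i}\tau: 0\le i<n/2\}$: $g_C=\tau$, $Z=\{e,\tau,\sigma^{n/2},\sigma^{n/2}\tau\}$, $\alpha_{\sigma^{2i}\tau}=\sigma^i$; - $\{\sigma^{2i+1}\tau: 0\le i<n/2\}$: $g_C=\sigma\tau$, $Z=\{e,\sigma\tau,\sigma^{n/2},\sigma^{n/2+1}\tau\}$, $\alpha_{\sigma^{2i+1}\tau}=\sigma^i$. **(2) Irreducible representations.** Each of the following assignments extends to a representation of $D(D_n)$ by matrices; these representations are irreducible and pairwise non-isomorphic, and every irreducible $D(D_n)$-module is isomorphic to one of them. - (from $C=\{e\}$ and $C=\{\sigma^{n/2}\}$) For $z\in\{e,\sigma^{n/2}\}$ and $a,b\in\{0,1\}$, of dimension $1$: $\sigma=(-1)^a$, $\tau=(-1)^b$, $g^*=\delta(g,z)$. For $z\in\{e,\sigma^{n/2}\}$ and $1\le k<n/2$, of dimension $2$: $\sigma=\begin{pmatrix}\omega^k&0\\0&\omega^{-k}\end{pmatrix}$, $\tau=\begin{pmatrix}0&1\\1&0\end{pmatrix}$, $g^*=\delta(g,z)I_2$.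 - (from $C=\{\sigma^k,\sigma^{-k}\}$) For $0\le j<n$ and $1\le k<n/2$, of dimension $2$: $\sigma=\begin{pmatrix}\omega^j&0\\0&\omega^{-j}\end{pmatrix}$, $\tau=\begin{pmatrix}0&1\\1&0\end{pmatrix}$, $(\sigma^k)^*=\begin{pmatrix}1&0\\0&0\end{pmatrix}$, $(\sigma^{-k})^*=\begin{pmatrix}0&0\\0&1\end{pmatrix}$, and $g^*=0$ for all other $g$. - (from $C=\{\sigma^{2j}\tau\}$) For $a,b\in\{0,1\}$, of dimension $n/2$: $\sigma=A$ and $\tau=(-1)^{a+b}B$, where, for $1\le i,j\le n/2$ and with the index equations $i=j+1$, $i+j=2$ read modulo $n/2$, $[A]_{ij}=(-1)^{a\,\delta(i,1)}\delta(i,j+1)$ and $[B]_{ij}=(-1)^{a\,\delta(i,1)}\delta(i+j,2)$; $(\sigma^{2j}\tau)^*=E^{j+1}_{j+1}$ for $0\le j<n/2$, and $g^*=0$ for all other $g$. Here $E^i_i$ is the matrix with a $1$ at position $(i,i)$ and zeros elsewhere. - (from $C=\{\sigma^{2j+1}\tau\}$) For $a,b\in\{0,1\}$, of dimension $n/2$: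 $\sigma=A$ as above and $\tau=(-1)^{a+b}B'$ with $[B']_{ij}=\delta(i+j,n/2+1)$, read modulo $n/2$; $(\sigma^{2j+1}\tau)^*=E^{j+1}_{j+1}$ for $0\le j<n/2$, and $g^*=0$ for all other $g$. Each representation listed from a class $C$ is isomorphic to the module $\bigoplus_{s\in C}\alpha_s\otimes V$ induced from some irreducible representation $V$ of $Z(g_C)$, with action $g(\alpha_s\otimes v)=\alpha_{t}\otimes(\alpha_{t}^{-1}g\alpha_s)v$, where $t=gsg^{-1}$, and $h^*(\alpha_s\otimes v)=\delta(h,s)\,\alpha_s\otimes v$. **(3) Counts.** The list consists of $8$ one-dimensional irreps from the two one-element classes, $8$ irreps of dimension $n/2$ (four from each of the two reflection classes), and $(n+2)(n/2-1)$ irreps of dimension $2$ from the classes contained in $\langle\sigma\rangle$. Hence, for every $d$, the number of isomorphism classes of $d$-dimensional irreps of $D(D_n)$ is $8\,\delta(d,1)+8\,\delta(d,n/2)+(n+2)(n/2-1)\,\delta(d,2)$. The sum of the squares of the dimensions of the irreps is $|D_n|^2=\dim_{\mathbb C} D(D_n)$. -/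

import Mathlib

open scoped Matrix

/-! ## The quantum double of a finite group -/

/-- The vector space underlying the quantum double `D(G)` of a finite group `G` over `ℂ`.
It has the basis `g h^*` (`g, h ∈ G`); the function `x` stands for `∑ g h, x g h • (g h^*)`. -/
def QuantumDouble (G : Type*) : Type _ := G → G → ℂ

namespace QuantumDouble

instance instAddCommGroup (G : Type*) : AddCommGroup (QuantumDouble G) :=
  inferInstanceAs (AddCommGroup (G → G → ℂ))

noncomputable instance instModule (G : Type*) : Module ℂ (QuantumDouble G) :=
  inferInstanceAs (Module ℂ (G → G → ℂ))

/-- The product with `h^* g = g (g⁻¹ h g)^*` and `g^* h^* = δ(g,h) h^*`, that is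
`(g h^*) (g' h'^*) = δ(g'⁻¹ h g', h') (g g') h'^*`, extended bilinearly. -/
noncomputable instance instMul (G : Type*) [Group G] [Fintype G] : Mul (QuantumDouble G) where
  mul x y := fun g h => ∑ u : G, x (g * u⁻¹) (u * h * u⁻¹) * y u h

/-- The unit `∑ h, e h^*`. -/
noncomputable instance instOne (G : Type*) [Group G] [DecidableEq G] : One (QuantumDouble G) where
  one := fun g _ => if g = 1 then 1 else 0

theorem mul_apply {G : Type*} [Group G] [Fintype G] (x y : QuantumDouble G) (g h : G) :
    (x * y) g h = ∑ u : G, x (g * u⁻¹) (u * h * u⁻¹) * y u h := rfl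

theorem one_apply {G : Type*} [Group G] [DecidableEq G] (g h : G) :
    (1 : QuantumDouble G) g h = if g = 1 then 1 else 0 := rfl

theorem add_apply {G : Type*} (x y : QuantumDouble G) (g h : G) :
    (x + y) g h = x g h + y g h := rfl

theorem zero_apply {G : Type*} (g h : G) : (0 : QuantumDouble G) g h = 0 := rfl

theorem smul_apply {G : Type*} (c : ℂ) (x : QuantumDouble G) (g h : G) :
    (c • x) g h = c * x g h := rfl

theorem ext {G : Type*} {x y : QuantumDouble G} (H : ∀ g h, x g h = y g h) : x = y :=
  funext fun g => funext fun h => H g h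

noncomputable instance instRing (G : Type*) [Group G] [Fintype G] [DecidableEq G] :
    Ring (QuantumDouble G) :=
  { instAddCommGroup G, instMul G, instOne G with
    left_distrib := fun x y z => ext fun g h => by
      simp only [mul_apply, add_apply, mul_add, Finset.sum_add_distrib]
    right_distrib := fun x y z => ext fun g h => by
      simp only [mul_apply, add_apply, add_mul, Finset.sum_add_distrib]
    zero_mul := fun x => ext fun g h => by
      simp [mul_apply, zero_apply]
    mul_zero := fun x => ext fun g h => by
      simp [mul_apply, zero_apply]
    one_mul := fun x => ext fun g h => by
      rw [mul_apply, Finset.sum_eq_single g]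
      · simp [one_apply]
      · intro u _ hu
        have : g * u⁻¹ ≠ 1 := fun H => hu (mul_inv_eq_one.mp H).symm
        simp [one_apply, this]
      · simp
    mul_one := fun x => ext fun g h => by
      rw [mul_apply, Finset.sum_eq_single 1]
      · simp [one_apply]
      · intro u _ hu
        simp [one_apply, hu]
      · simp
    mul_assoc := fun x y z => ext fun g h => by
      simp only [mul_apply, Finset.sum_mul, Finset.mul_sum]
      rw [Finset.sum_comm]
      conv_rhs => rw [Finset.sum_comm]
      rw [Finset.sum_comm]
      refine Finset.sum_congr rfl fun u _ => ?_
      refine Fintype.sum_equiv (Equiv.mulRight u) _ _ fun v => ?_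
      simp [mul_assoc] }

noncomputable instance instAlgebra (G : Type*) [Group G] [Fintype G] [DecidableEq G] :
    Algebra ℂ (QuantumDouble G) :=
  Algebra.ofModule
    (fun c x y => ext fun g h => by
      simp only [mul_apply, smul_apply, Finset.mul_sum, mul_assoc])
    (fun c x y => ext fun g h => by
      simp only [mul_apply, smul_apply, Finset.mul_sum]
      exact Finset.sum_congr rfl fun u _ => by ring)

/-- The element `g = g ε` of `D(G)`, where `ε = ∑ h, h^*`. -/
noncomputable def of {G : Type*} [DecidableEq G] (g : G) : QuantumDouble G :=
  fun x _ => if x = g then 1 else 0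

/-- The element `h^* = e h^*` of `D(G)`. -/
noncomputable def dual {G : Type*} [Group G] [DecidableEq G] (h : G) : QuantumDouble G :=
  fun x y => if x = 1 ∧ y = h then 1 else 0

theorem of_mul_of {G : Type*} [Group G] [Fintype G] [DecidableEq G] (g g' : G) :
    of g * of g' = of (g * g') := ext fun x y => by
  simp [mul_apply, of, mul_inv_eq_iff_eq_mul]

theorem of_mul_dual {G : Type*} [Group G] [Fintype G] [DecidableEq G] (g h : G) :
    of g * dual h = fun x y => if x = g ∧ y = h then 1 else 0 := ext fun x y => by
  rw [mul_apply, Finset.sum_eq_single 1]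
  · by_cases hx : x = g <;> simp [of, dual, hx]
  · intro u _ hu
    simp [dual, hu]
  · simp

theorem dual_mul_of {G : Type*} [Group G] [Fintype G] [DecidableEq G] (g h : G) :
    dual h * of g = of g * dual (g⁻¹ * h * g) := by
  rw [of_mul_dual]
  refine ext fun x y => ?_
  rw [mul_apply, Finset.sum_eq_single g]
  · have : g * y * g⁻¹ = h ↔ y = g⁻¹ * h * g :=
      ⟨fun H => by rw [← H]; group, fun H => by rw [H]; group⟩
    simp [of, dual, mul_inv_eq_one, this]
  · intro u _ hu
    simp [of, hu]
  · simp

theorem dual_mul_dual {G : Type*} [Group G] [Fintype G] [DecidableEq G] (g h : G) :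
    dual g * dual h = if g = h then dual h else 0 := ext fun x y => by
  rw [mul_apply, Finset.sum_eq_single 1]
  · by_cases hg : g = h
    · subst hg
      by_cases hx : x = 1 <;> by_cases hy : y = g <;> simp [dual, hx, hy]
    · rw [if_neg hg, zero_apply]
      by_cases hy : y = h
      · simp [dual, hy, Ne.symm hg]
      · simp [dual, hy]
  · intro u _ hu
    simp [dual, hu]
  · simp

end QuantumDouble

/-! ## Matrix representations of an algebra -/

/-- The left module `ℂ^d` of column vectors on which `a ∈ A` acts by the matrix `ρ a`. -/
def RepModule {A : Type*} [Ring A] [Algebra ℂ A] {d : ℕ}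
    (_ρ : A →ₐ[ℂ] Matrix (Fin d) (Fin d) ℂ) : Type := Fin d → ℂ

namespace RepModule

instance instAddCommGroup {A : Type*} [Ring A] [Algebra ℂ A] {d : ℕ}
    (ρ : A →ₐ[ℂ] Matrix (Fin d) (Fin d) ℂ) : AddCommGroup (RepModule ρ) :=
  inferInstanceAs (AddCommGroup (Fin d → ℂ))

noncomputable instance instModule {A : Type*} [Ring A] [Algebra ℂ A] {d : ℕ}
    (ρ : A →ₐ[ℂ] Matrix (Fin d) (Fin d) ℂ) : Module A (RepModule ρ) where
  smul a v := (ρ a *ᵥ v : Fin d → ℂ)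
  one_smul v := (congrArg (fun M => M *ᵥ (v : Fin d → ℂ)) (map_one ρ)).trans
    (Matrix.one_mulVec _)
  mul_smul a b v := (congrArg (fun M => M *ᵥ (v : Fin d → ℂ)) (map_mul ρ a b)).trans
    (Matrix.mulVec_mulVec _ _ _).symm
  smul_zero a := Matrix.mulVec_zero (ρ a)
  smul_add a v w := Matrix.mulVec_add (ρ a) v w
  add_smul a b v := (congrArg (fun M => M *ᵥ (v : Fin d → ℂ)) (map_add ρ a b)).trans
    (Matrix.add_mulVec _ _ _)
  zero_smul v := (congrArg (fun M => M *ᵥ (v : Fin d → ℂ)) (map_zero ρ)).trans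
    (Matrix.zero_mulVec _)

end RepModule

/-- The irreducible matrix representations of `A` of dimension `d`. -/
def Irrep (A : Type*) [Ring A] [Algebra ℂ A] (d : ℕ) : Type _ :=
  {ρ : A →ₐ[ℂ] Matrix (Fin d) (Fin d) ℂ // IsSimpleModule A (RepModule ρ)}

/-- Isomorphism of irreducible matrix representations of the same dimension. -/
def irrepSetoid (A : Type*) [Ring A] [Algebra ℂ A] (d : ℕ) : Setoid (Irrep A d) where
  r ρ ρ' := Nonempty (RepModule ρ.1 ≃ₗ[A] RepModule ρ'.1)
  iseqv :=
    { refl := fun _ => ⟨LinearEquiv.refl _ _⟩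
      symm := fun ⟨e⟩ => ⟨e.symm⟩
      trans := fun ⟨e⟩ ⟨f⟩ => ⟨e.trans f⟩ }

/-- The number of `d`-dimensional irreducible representations of `A` up to isomorphism. -/
noncomputable def numIrreps (A : Type*) [Ring A] [Algebra ℂ A] (d : ℕ) : ℕ :=
  Nat.card (Quotient (irrepSetoid A d))

/-- Let `s : ι → G` enumerate the conjugacy class of `g₀`, let `s i = α i * g₀ * (α i)⁻¹`, and let
`π` be a representation of the centraliser of `g₀` on `V`.  The predicate says that the
representation `ρ` of `D(G)` is isomorphic to the induced one on `⨁ i, α i ⊗ V`, in which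
`g (α_s ⊗ v) = α_t ⊗ (α_t⁻¹ g α_s) v` with `t = g s g⁻¹`, and `h^* (α_s ⊗ v) = δ(h,s) α_s ⊗ v`.
The vector `α i ⊗ v` is `Φ (Pi.single i v)`. -/
def IsInducedFrom {G : Type*} [Group G] [Fintype G] [DecidableEq G] {d : ℕ}
    (ρ : QuantumDouble G →ₐ[ℂ] Matrix (Fin d) (Fin d) ℂ) (g₀ : G)
    {ι : Type} [DecidableEq ι] (s α : ι → G)
    {V : Type} [AddCommGroup V] [Module ℂ V]
    (π : Representation ℂ (Subgroup.centralizer {g₀} : Subgroup G) V) : Prop :=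
  ∃ Φ : (ι → V) ≃ₗ[ℂ] (Fin d → ℂ),
    (∀ (g : G) (i j : ι) (z : (Subgroup.centralizer {g₀} : Subgroup G)) (v : V),
      s j = g * s i * g⁻¹ → (z : G) = (α j)⁻¹ * g * α i →
        ρ (QuantumDouble.of g) *ᵥ Φ (Pi.single i v) = Φ (Pi.single j (π z v))) ∧
    (∀ (h : G) (i : ι) (v : V),
      ρ (QuantumDouble.dual h) *ᵥ Φ (Pi.single i v) =
        if h = s i then Φ (Pi.single i v) else 0)

/-! ## The dihedral group `D_n`, `n` even: conjugacy classes and centralisers -/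

namespace DihedralDouble

/-- The generator `σ` of `D_n`. -/
def σ (n : ℕ) : DihedralGroup n := DihedralGroup.r 1

/-- The generator `τ` of `D_n`. -/
def τ (n : ℕ) : DihedralGroup n := DihedralGroup.sr 0

theorem relations (n : ℕ) :
    σ n ^ n = 1 ∧ τ n ^ 2 = 1 ∧ τ n * σ n = σ n ^ ((n : ℤ) - 1) * τ n := by
  refine ⟨?_, ?_, ?_⟩
  · simp [σ]
  · simp [τ, pow_two]
  · simp [σ, τ]

/-- The integers `k` with `1 ≤ k < n/2`. -/
abbrev HalfRange (n : ℕ) : Type := {k : Fin (n / 2) // 1 ≤ k.val}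

/-- Labels of the conjugacy classes of `D_n`, `n` even. -/
inductive ClassLabel (n : ℕ) : Type
  /-- `{e}` -/
  | one
  /-- `{σ^(n/2)}` -/
  | central
  /-- `{σ^k, σ^(-k)}`, `1 ≤ k < n/2` -/
  | rot (k : HalfRange n)
  /-- `{σ^(2i) τ | 0 ≤ i < n/2}` -/
  | reflEven
  /-- `{σ^(2i+1) τ | 0 ≤ i < n/2}` -/
  | reflOdd

namespace ClassLabel

/-- The number of elements of the class. -/
def size {n : ℕ} : ClassLabel n → ℕ
  | one => 1
  | central => 1
  | rot _ => 2
  | reflEven => n / 2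
  | reflOdd => n / 2

/-- The list of the elements of the class. -/
def elem {n : ℕ} : (c : ClassLabel n) → Fin c.size → DihedralGroup n
  | one => (fun _ => 1 : Fin 1 → DihedralGroup n)
  | central => (fun _ => σ n ^ (n / 2) : Fin 1 → DihedralGroup n)
  | rot k => (![σ n ^ (k.val : ℕ), (σ n ^ (k.val : ℕ))⁻¹] : Fin 2 → DihedralGroup n)
  | reflEven => (fun i => σ n ^ (2 * (i : ℕ)) * τ n : Fin (n / 2) → DihedralGroup n)
  | reflOdd => (fun i => σ n ^ (2 * (i : ℕ) + 1) * τ n : Fin (n / 2) → DihedralGroup n)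

/-- The chosen representative `g_k` of the class. -/
def rep {n : ℕ} : ClassLabel n → DihedralGroup n
  | one => 1
  | central => σ n ^ (n / 2)
  | rot k => σ n ^ (k.val : ℕ)
  | reflEven => τ n
  | reflOdd => σ n * τ n

/-- The listed centraliser of the representative, as a set. -/
def centraliser {n : ℕ} : ClassLabel n → Set (DihedralGroup n)
  | one => Set.univ
  | central => Set.univ
  | rot _ => {g | ∃ i < n, g = σ n ^ i}
  | reflEven => {1, τ n, σ n ^ (n / 2), σ n ^ (n / 2) * τ n}
  | reflOdd => {1, σ n * τ n, σ n ^ (n / 2), σ n ^ (n / 2 + 1) * τ n}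

/-- The elements `α_s`, `s` in the class; `alpha c i` belongs to `s = elem c i`. -/
def alpha {n : ℕ} : (c : ClassLabel n) → Fin c.size → DihedralGroup n
  | one => (fun _ => 1 : Fin 1 → DihedralGroup n)
  | central => (fun _ => 1 : Fin 1 → DihedralGroup n)
  | rot _ => (![1, τ n] : Fin 2 → DihedralGroup n)
  | reflEven => (fun i => σ n ^ (i : ℕ) : Fin (n / 2) → DihedralGroup n)
  | reflOdd => (fun i => σ n ^ (i : ℕ) : Fin (n / 2) → DihedralGroup n)

end ClassLabel

/-! ## The explicit irreducible representations of `D(D_n)`, `n` even -/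

/-- Labels of the irreducible representations of `D(D_n)`, `n` even. -/
inductive IrrepLabel (n : ℕ) : Type
  | oneDim1 (a b : Fin 2)
  | oneDim2 (k : HalfRange n)
  | centralDim1 (a b : Fin 2)
  | centralDim2 (k : HalfRange n)
  | rot (j : Fin n) (k : HalfRange n)
  | reflEven (a b : Fin 2)
  | reflOdd (a b : Fin 2)
  deriving DecidableEq, Fintype

/-- `ω = exp(2πi/n)`. -/
noncomputable def ω (n : ℕ) : ℂ := Complex.exp (2 * Real.pi * Complex.I / n)

namespace IrrepLabel

/-- The conjugacy class inducing the representation. -/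
def cls {n : ℕ} : IrrepLabel n → ClassLabel n
  | oneDim1 _ _ => .one
  | oneDim2 _ => .one
  | centralDim1 _ _ => .central
  | centralDim2 _ => .central
  | rot _ k => .rot k
  | reflEven _ _ => .reflEven
  | reflOdd _ _ => .reflOdd

/-- The dimension of the representation. -/
def dim {n : ℕ} : IrrepLabel n → ℕ
  | oneDim1 _ _ => 1
  | oneDim2 _ => 2
  | centralDim1 _ _ => 1
  | centralDim2 _ => 2
  | rot _ _ => 2
  | reflEven _ _ => n / 2
  | reflOdd _ _ => n / 2

/-- The matrix `A` with `[A]_{ij} = (-1)^{a δ(i,1)} δ(i, j+1)`, indices modulo `n/2`.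
Rows and columns are numbered from `1` in the formula, and from `0` in `Fin (n / 2)`. -/
noncomputable def matA (n : ℕ) (a : Fin 2) : Matrix (Fin (n / 2)) (Fin (n / 2)) ℂ :=
  Matrix.of fun i j =>
    (if (i : ℕ) + 1 = 1 then (-1) ^ (a : ℕ) else 1) *
      (if (i : ℕ) + 1 ≡ ((j : ℕ) + 1) + 1 [MOD n / 2] then 1 else 0)

/-- The matrix `B` with `[B]_{ij} = (-1)^{a δ(i,1)} δ(i+j, 2)`, indices modulo `n/2`. -/
noncomputable def matBEven (n : ℕ) (a : Fin 2) : Matrix (Fin (n / 2)) (Fin (n / 2)) ℂ :=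
  Matrix.of fun i j =>
    (if (i : ℕ) + 1 = 1 then (-1) ^ (a : ℕ) else 1) *
      (if ((i : ℕ) + 1) + ((j : ℕ) + 1) ≡ 2 [MOD n / 2] then 1 else 0)

/-- The matrix `B` with `[B]_{ij} = δ(i+j, n/2+1)`, indices modulo `n/2`. -/
noncomputable def matBOdd (n : ℕ) : Matrix (Fin (n / 2)) (Fin (n / 2)) ℂ :=
  Matrix.of fun i j =>
    if ((i : ℕ) + 1) + ((j : ℕ) + 1) ≡ n / 2 + 1 [MOD n / 2] then 1 else 0

/-- The matrix of `σ`. -/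
noncomputable def sigmaMat {n : ℕ} : (ℓ : IrrepLabel n) → Matrix (Fin ℓ.dim) (Fin ℓ.dim) ℂ
  | oneDim1 a _ => (!![(-1) ^ (a : ℕ)] : Matrix (Fin 1) (Fin 1) ℂ)
  | oneDim2 k =>
      (!![ω n ^ (k.val : ℕ), 0; 0, (ω n ^ (k.val : ℕ))⁻¹] : Matrix (Fin 2) (Fin 2) ℂ)
  | centralDim1 a _ => (!![(-1) ^ (a : ℕ)] : Matrix (Fin 1) (Fin 1) ℂ)
  | centralDim2 k =>
      (!![ω n ^ (k.val : ℕ), 0; 0, (ω n ^ (k.val : ℕ))⁻¹] : Matrix (Fin 2) (Fin 2) ℂ)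
  | rot j _ =>
      (!![ω n ^ (j : ℕ), 0; 0, (ω n ^ (j : ℕ))⁻¹] : Matrix (Fin 2) (Fin 2) ℂ)
  | reflEven a _ => matA n a
  | reflOdd a _ => matA n a

/-- The matrix of `τ`. -/
noncomputable def tauMat {n : ℕ} : (ℓ : IrrepLabel n) → Matrix (Fin ℓ.dim) (Fin ℓ.dim) ℂ
  | oneDim1 _ b => (!![(-1) ^ (b : ℕ)] : Matrix (Fin 1) (Fin 1) ℂ)
  | oneDim2 _ => (!![0, 1; 1, 0] : Matrix (Fin 2) (Fin 2) ℂ)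
  | centralDim1 _ b => (!![(-1) ^ (b : ℕ)] : Matrix (Fin 1) (Fin 1) ℂ)
  | centralDim2 _ => (!![0, 1; 1, 0] : Matrix (Fin 2) (Fin 2) ℂ)
  | rot _ _ => (!![0, 1; 1, 0] : Matrix (Fin 2) (Fin 2) ℂ)
  | reflEven a b => ((-1 : ℂ) ^ ((a : ℕ) + (b : ℕ))) • matBEven n a
  | reflOdd a b => ((-1 : ℂ) ^ ((a : ℕ) + (b : ℕ))) • matBOdd n

/-- The matrix of the dual element `g^*`.  For the reflection classes the sum is `E^{j+1}_{j+1}`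
if `g = σ^(2j) τ` (respectively `g = σ^(2j+1) τ`), `0 ≤ j < n/2`, and `0` otherwise. -/
noncomputable def dualMat {n : ℕ} :
    (ℓ : IrrepLabel n) → DihedralGroup n → Matrix (Fin ℓ.dim) (Fin ℓ.dim) ℂ
  | oneDim1 _ _ => fun g => (if g = 1 then 1 else 0 : Matrix (Fin 1) (Fin 1) ℂ)
  | oneDim2 _ => fun g => (if g = 1 then 1 else 0 : Matrix (Fin 2) (Fin 2) ℂ)
  | centralDim1 _ _ => fun g =>
      (if g = σ n ^ (n / 2) then 1 else 0 : Matrix (Fin 1) (Fin 1) ℂ)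
  | centralDim2 _ => fun g =>
      (if g = σ n ^ (n / 2) then 1 else 0 : Matrix (Fin 2) (Fin 2) ℂ)
  | rot _ k => fun g =>
      (if g = σ n ^ (k.val : ℕ) then !![1, 0; 0, 0]
        else if g = (σ n ^ (k.val : ℕ))⁻¹ then !![0, 0; 0, 1]
        else 0 : Matrix (Fin 2) (Fin 2) ℂ)
  | reflEven _ _ => fun g =>
      (∑ j : Fin (n / 2), if g = σ n ^ (2 * (j : ℕ)) * τ n then Matrix.single j j 1 else 0 :
        Matrix (Fin (n / 2)) (Fin (n / 2)) ℂ)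
  | reflOdd _ _ => fun g =>
      (∑ j : Fin (n / 2), if g = σ n ^ (2 * (j : ℕ) + 1) * τ n then Matrix.single j j 1 else 0 :
        Matrix (Fin (n / 2)) (Fin (n / 2)) ℂ)

end IrrepLabel

end DihedralDouble

/-! ## Matrix representations as modules -/

namespace RepModule

section

variable {A : Type*} [Ring A] [Algebra ℂ A] {d d' : ℕ}
  {ρ : A →ₐ[ℂ] Matrix (Fin d) (Fin d) ℂ} {ρ' : A →ₐ[ℂ] Matrix (Fin d') (Fin d') ℂ}

/-! The classification rests on a dimension count. Suppose finitely many irreducible matrix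
representations of a finite-dimensional complex algebra are pairwise non-isomorphic. By Schur's
lemma, the endomorphisms of their direct sum act as a scalar on each summand, so Jacobson density
makes the algebra map onto the product of the matrix algebras (`piHom_surjective`). If the squares
of the dimensions add up to the dimension of the algebra, this map is an isomorphism, and a nonzero
vector of any simple module survives some diagonal matrix unit, which yields an isomorphism with a
member of the family (`exists_equiv_of_isSimpleModule`).

For `D(D_n)` it remains to see that the listed matrices are such a family. A representation of
`D(G)` is a representation of `G` graded by `G`, where `g` sends degree `h` to degree `g h g⁻¹` and
`h^*` projects to degree `h` (`gradedRep`). For the dihedral group both the relations and the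
compatibility with the grading need checking on `σ` and `τ` only. Irreducibility holds because the
image contains all matrix units (`toRep_surjective`). Traces separate the labels (`eq_of_equiv`):
the traces of the `h^*` determine the class, and further traces recover the remaining parameters.
For the two-element rotation classes and the reflection classes, these are traces of centraliser
elements on the component of degree `g_C`. The squares of the dimensions then add up to `(2n)²`.

Induction from the centraliser is a general fact (`exists_isInducedFrom`): if the degrees of an
irreducible representation lie in the class of `g₀`, its component of degree `g₀` is a module over
the centraliser, the translates by the `α_s` are the other components, and a subrepresentation of
the component induces a submodule of the whole. -/

noncomputable instance instModuleComplex (ρ : A →ₐ[ℂ] Matrix (Fin d) (Fin d) ℂ) :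
    Module ℂ (RepModule ρ) :=
  inferInstanceAs (Module ℂ (Fin d → ℂ))

instance instFiniteDimensional (ρ : A →ₐ[ℂ] Matrix (Fin d) (Fin d) ℂ) :
    FiniteDimensional ℂ (RepModule ρ) :=
  inferInstanceAs (FiniteDimensional ℂ (Fin d → ℂ))

/-- The column vector underlying an element of the module. -/
def toVec (ρ : A →ₐ[ℂ] Matrix (Fin d) (Fin d) ℂ) : RepModule ρ ≃ₗ[ℂ] (Fin d → ℂ) :=
  LinearEquiv.refl ℂ (Fin d → ℂ)

theorem toVec_smul (a : A) (v : RepModule ρ) : toVec ρ (a • v) = ρ a *ᵥ toVec ρ v := rfl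

theorem smul_symm_toVec (a : A) (v : Fin d → ℂ) :
    a • (toVec ρ).symm v = (toVec ρ).symm (ρ a *ᵥ v) := rfl

instance instIsScalarTower (ρ : A →ₐ[ℂ] Matrix (Fin d) (Fin d) ℂ) :
    IsScalarTower ℂ A (RepModule ρ) where
  smul_assoc c a v := by
    have h : toVec ρ ((c • a) • v) = c • toVec ρ (a • v) := by
      rw [toVec_smul, toVec_smul, map_smul, Matrix.smul_mulVec]
    exact h

theorem finrank_eq (ρ : A →ₐ[ℂ] Matrix (Fin d) (Fin d) ℂ) :
    Module.finrank ℂ (RepModule ρ) = d :=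
  Module.finrank_fin_fun ℂ

theorem dim_eq_of_equiv (e : RepModule ρ ≃ₗ[A] RepModule ρ') : d = d' := by
  rw [← finrank_eq ρ, ← finrank_eq ρ']
  exact (e.restrictScalars ℂ).finrank_eq

/-- An isomorphism conjugates the two actions of `a`. Traces are the invariants that tell the listed
representations apart. -/
theorem trace_eq_of_equiv (e : RepModule ρ ≃ₗ[A] RepModule ρ') (a : A) :
    (ρ a).trace = (ρ' a).trace := by
  let f : (Fin d → ℂ) ≃ₗ[ℂ] (Fin d' → ℂ) :=
    (toVec ρ).symm ≪≫ₗ e.restrictScalars ℂ ≪≫ₗ toVec ρ'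
  have hconj : f.conj (Matrix.toLin' (ρ a)) = Matrix.toLin' (ρ' a) := by
    refine LinearMap.ext fun v => ?_
    have h := e.map_smul a (e.symm ((toVec ρ').symm v))
    rw [e.apply_symm_apply] at h
    exact h
  have key := LinearMap.trace_conj' (Matrix.toLin' (ρ a)) f
  rw [hconj, Matrix.trace_toLin'_eq, Matrix.trace_toLin'_eq] at key
  exact key.symm

/-- A surjective matrix representation is irreducible. -/
theorem isSimpleModule_of_surjective [NeZero d] (h : Function.Surjective ρ) :
    IsSimpleModule A (RepModule ρ) := by
  rw [isSimpleModule_iff_toSpanSingleton_surjective]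
  refine ⟨inferInstanceAs (Nontrivial (Fin d → ℂ)), fun v hv w => ?_⟩
  obtain ⟨i, hi⟩ : ∃ i, toVec ρ v i ≠ 0 :=
    Function.ne_iff.mp fun h => hv ((toVec ρ).map_eq_zero_iff.mp h)
  obtain ⟨a, ha⟩ := h (Matrix.vecMulVec (toVec ρ w) (Pi.single i (toVec ρ v i)⁻¹))
  refine ⟨a, (toVec ρ).injective ?_⟩
  rw [LinearMap.toSpanSingleton_apply, toVec_smul, ha, Matrix.vecMulVec_mulVec,
    single_dotProduct, inv_mul_cancel₀ hi]
  simp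

/-- A representation whose image contains the diagonal matrix units and in which every index is
linked with a fixed one is surjective. -/
theorem surjective_of_single_mem_range (j₀ : Fin d)
    (hdiag : ∀ i, ∃ a, ρ a = Matrix.single i i 1)
    (hlink : ∀ i, ∃ a b, ρ a i j₀ ≠ 0 ∧ ρ b j₀ i ≠ 0) : Function.Surjective ρ := by
  have hunit : ∀ i j, ∃ a, ρ a = Matrix.single i j 1 := by
    intro i j
    obtain ⟨e, he⟩ := hdiag i
    obtain ⟨e₀, he₀⟩ := hdiag j₀
    obtain ⟨f, hf⟩ := hdiag j
    obtain ⟨a, -, ha, -⟩ := hlink i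
    obtain ⟨-, b, -, hb⟩ := hlink j
    -- Cutting `a` and `b` down by diagonal units leaves multiples of `E_{i j₀}` and `E_{j₀ j}`,
    -- whose product is a nonzero multiple of `E_{ij}`.
    refine ⟨(ρ a i j₀ * ρ b j₀ j)⁻¹ • ((e * a * e₀) * (e₀ * b * f)), ?_⟩
    rw [map_smul, map_mul, map_mul, map_mul, map_mul, map_mul, he, he₀, hf,
      Matrix.single_mul_mul_single, Matrix.single_mul_mul_single, Matrix.single_mul_single_same,
      Matrix.smul_single]
    congr 1
    have := mul_ne_zero ha hb
    simp only [smul_eq_mul]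
    field_simp
  intro M
  choose u hu using hunit
  refine ⟨∑ i, ∑ j, M i j • u i j, ?_⟩
  conv_rhs => rw [Matrix.matrix_eq_sum_single M]
  simp [hu, Matrix.smul_single]

end

/-! ## Families of pairwise non-isomorphic irreducible representations -/

section

variable {A : Type*} [Ring A] [Algebra ℂ A] {L : Type*} {dim : L → ℕ}
  (ρ : ∀ ℓ, A →ₐ[ℂ] Matrix (Fin (dim ℓ)) (Fin (dim ℓ)) ℂ)

/-- The simultaneous action on a family of matrix representations. -/
noncomputable def piHom : A →ₗ[ℂ] ∀ ℓ, Matrix (Fin (dim ℓ)) (Fin (dim ℓ)) ℂ :=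
  LinearMap.pi fun ℓ => (ρ ℓ).toLinearMap

variable {ρ}

/-- Schur's lemma twice: the diagonal blocks of `φ` are scalars because `ℂ` is algebraically closed,
and the off-diagonal blocks vanish because distinct members are not isomorphic. -/
theorem exists_smul_of_end [Fintype L] (hs : ∀ ℓ, IsSimpleModule A (RepModule (ρ ℓ)))
    (hne : ∀ ℓ ℓ', Nonempty (RepModule (ρ ℓ) ≃ₗ[A] RepModule (ρ ℓ')) → ℓ = ℓ')
    (φ : Module.End A (∀ ℓ, RepModule (ρ ℓ))) (ℓ : L) :
    ∃ c : ℂ, ∀ m, φ m ℓ = c • m ℓ := by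
  classical
  obtain ⟨c, hc⟩ := (IsSimpleModule.algebraMap_end_bijective_of_isAlgClosed ℂ).2
    ((LinearMap.proj ℓ ∘ₗ φ ∘ₗ LinearMap.single A (fun ℓ => RepModule (ρ ℓ)) ℓ :
      Module.End A (RepModule (ρ ℓ))))
  refine ⟨c, fun m => ?_⟩
  have hm : m = ∑ k, Pi.single k (m k) := (Finset.univ_sum_single m).symm
  conv_lhs => rw [hm]
  rw [map_sum, Finset.sum_apply, Finset.sum_eq_single ℓ]
  · exact (LinearMap.congr_fun hc (m ℓ)).symm
  · intro k _ hk
    rcases LinearMap.bijective_or_eq_zero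
      (LinearMap.proj ℓ ∘ₗ φ ∘ₗ LinearMap.single A (fun ℓ => RepModule (ρ ℓ)) k) with h | h
    · exact absurd (hne k ℓ ⟨LinearEquiv.ofBijective _ h⟩) hk
    · exact LinearMap.congr_fun h (m k)
  · simp

/-- A family of matrices acts on the direct sum and commutes with its endomorphisms. -/
noncomputable def diagEnd [Fintype L] (hs : ∀ ℓ, IsSimpleModule A (RepModule (ρ ℓ)))
    (hne : ∀ ℓ ℓ', Nonempty (RepModule (ρ ℓ) ≃ₗ[A] RepModule (ρ ℓ')) → ℓ = ℓ')
    (X : ∀ ℓ, Matrix (Fin (dim ℓ)) (Fin (dim ℓ)) ℂ) :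
    Module.End (Module.End A (∀ ℓ, RepModule (ρ ℓ))) (∀ ℓ, RepModule (ρ ℓ)) where
  toFun m ℓ := (toVec (ρ ℓ)).symm (X ℓ *ᵥ toVec (ρ ℓ) (m ℓ))
  map_add' m m' := funext fun ℓ => by
    simp only [Pi.add_apply, map_add, Matrix.mulVec_add]
  map_smul' φ m := funext fun ℓ => by
    obtain ⟨c, hc⟩ := exists_smul_of_end hs hne φ ℓ
    rw [RingHom.id_apply, Module.End.smul_def, Module.End.smul_def, hc, hc, map_smul,
      Matrix.mulVec_smul, map_smul]

theorem diagEnd_apply [Fintype L] (hs : ∀ ℓ, IsSimpleModule A (RepModule (ρ ℓ)))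
    (hne : ∀ ℓ ℓ', Nonempty (RepModule (ρ ℓ) ≃ₗ[A] RepModule (ρ ℓ')) → ℓ = ℓ')
    (X : ∀ ℓ, Matrix (Fin (dim ℓ)) (Fin (dim ℓ)) ℂ) (m : ∀ ℓ, RepModule (ρ ℓ)) (ℓ : L) :
    diagEnd hs hne X m ℓ = (toVec (ρ ℓ)).symm (X ℓ *ᵥ toVec (ρ ℓ) (m ℓ)) := rfl

/-- Burnside's theorem for several representations. -/
theorem piHom_surjective [Fintype L] (hs : ∀ ℓ, IsSimpleModule A (RepModule (ρ ℓ)))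
    (hne : ∀ ℓ ℓ', Nonempty (RepModule (ρ ℓ) ≃ₗ[A] RepModule (ρ ℓ')) → ℓ = ℓ') :
    Function.Surjective (piHom ρ) := by
  classical
  intro X
  -- Density yields one `a` that agrees with `X` on the finitely many standard basis vectors of all
  -- summands, hence acts as `X`.
  obtain ⟨a, ha⟩ := jacobson_density (diagEnd hs hne X)
    (Finset.univ.image fun p : (ℓ : L) × Fin (dim ℓ) =>
      (Pi.single p.1 ((toVec (ρ p.1)).symm (Pi.single p.2 1)) : ∀ k, RepModule (ρ k)))
  refine ⟨a, funext fun ℓ => Matrix.ext_of_mulVec_single fun j => ?_⟩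
  have h := congrFun (ha _ (Finset.mem_image_of_mem _ (Finset.mem_univ ⟨ℓ, j⟩))) ℓ
  rw [diagEnd_apply, Pi.smul_apply, Pi.single_eq_same, LinearEquiv.apply_symm_apply,
    smul_symm_toVec] at h
  exact ((toVec (ρ ℓ)).symm.injective h).symm

theorem piHom_bijective [Fintype L] [FiniteDimensional ℂ A]
    (hs : ∀ ℓ, IsSimpleModule A (RepModule (ρ ℓ)))
    (hne : ∀ ℓ ℓ', Nonempty (RepModule (ρ ℓ) ≃ₗ[A] RepModule (ρ ℓ')) → ℓ = ℓ')
    (hdim : ∑ ℓ, dim ℓ ^ 2 = Module.finrank ℂ A) : Function.Bijective (piHom ρ) := by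
  have hsurj := piHom_surjective hs hne
  refine ⟨(LinearMap.injective_iff_surjective_of_finrank_eq_finrank ?_).mpr hsurj, hsurj⟩
  rw [Module.finrank_pi_fintype, ← hdim]
  exact Finset.sum_congr rfl fun ℓ _ => by simp [Module.finrank_matrix, sq]

/-- If the squares of the dimensions of pairwise non-isomorphic irreducible representations add up
to the dimension of the algebra, then every simple module is isomorphic to one of them. -/
theorem exists_equiv_of_isSimpleModule [Fintype L] [FiniteDimensional ℂ A]
    (hs : ∀ ℓ, IsSimpleModule A (RepModule (ρ ℓ)))
    (hne : ∀ ℓ ℓ', Nonempty (RepModule (ρ ℓ) ≃ₗ[A] RepModule (ρ ℓ')) → ℓ = ℓ')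
    (hdim : ∑ ℓ, dim ℓ ^ 2 = Module.finrank ℂ A)
    (V : Type*) [AddCommGroup V] [Module A V] [IsSimpleModule A V] :
    ∃ ℓ, Nonempty (V ≃ₗ[A] RepModule (ρ ℓ)) := by
  classical
  have hbij := piHom_bijective hs hne hdim
  let Ψ := LinearEquiv.ofBijective _ hbij
  have hΨ : ∀ a ℓ, Ψ a ℓ = ρ ℓ a := fun _ _ => rfl
  have := IsSimpleModule.nontrivial A V
  obtain ⟨v, hv⟩ := exists_ne (0 : V)
  -- `u ℓ M` is the element of `A` acting as `M` in the representation `ℓ` and as zero in all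
  -- others.
  let u : ∀ ℓ, Matrix (Fin (dim ℓ)) (Fin (dim ℓ)) ℂ → A := fun ℓ M => Ψ.symm (Pi.single ℓ M)
  have hsum : ∑ ℓ, ∑ j, u ℓ (Matrix.single j j 1) = 1 := by
    apply Ψ.injective
    funext ℓ
    have h1 : ∀ k, ∑ j, Ψ (u k (Matrix.single j j 1)) = Pi.single k 1 := by
      intro k
      simp only [u, LinearEquiv.apply_symm_apply]
      rw [← Matrix.sum_single_one]
      exact (map_sum (AddMonoidHom.single
        (fun ℓ => Matrix (Fin (dim ℓ)) (Fin (dim ℓ)) ℂ) k) _ _).symm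
    rw [map_sum, hΨ, map_one]
    simp only [map_sum, h1]
    rw [Finset.univ_sum_single]
  obtain ⟨ℓ, j, hj⟩ : ∃ ℓ j, u ℓ (Matrix.single j j 1) • v ≠ 0 := by
    by_contra! h
    apply hv
    rw [← one_smul A v, ← hsum, Finset.sum_smul]
    exact Finset.sum_eq_zero fun ℓ _ => by
      rw [Finset.sum_smul]; exact Finset.sum_eq_zero fun j _ => h ℓ j
  -- The column vector `w` is placed in the `j`-th column of block `ℓ`. Matrices supported on that
  -- column form a left ideal isomorphic to the `ℓ`-th module, and `g` applies them to `v`. Being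
  -- nonzero between simple modules, `g` is bijective.
  let g : RepModule (ρ ℓ) →ₗ[A] V :=
    { toFun := fun w => u ℓ (Matrix.vecMulVec (toVec _ w) (Pi.single j 1)) • v
      map_add' := fun w w' => by
        rw [← add_smul, ← map_add, ← Pi.single_add, ← Matrix.add_vecMulVec, map_add]
      map_smul' := fun a w => by
        rw [RingHom.id_apply, smul_smul]
        congr 1
        apply Ψ.injective
        funext k
        rw [hΨ _ k, hΨ _ k, map_mul, ← hΨ _ k, ← hΨ (u ℓ _) k, LinearEquiv.apply_symm_apply,
          LinearEquiv.apply_symm_apply]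
        by_cases hk : k = ℓ
        · subst hk
          rw [Pi.single_eq_same, Pi.single_eq_same, Matrix.mul_vecMulVec,
            toVec_smul]
        · rw [Pi.single_eq_of_ne hk, Pi.single_eq_of_ne hk, mul_zero] }
  have hg : g ≠ 0 := by
    intro h
    apply hj
    have := LinearMap.congr_fun h ((toVec (ρ ℓ)).symm (Pi.single j 1))
    rw [Matrix.single_eq_single_vecMulVec_single]
    exact this
  have := hs ℓ
  exact ⟨ℓ, ⟨(LinearEquiv.ofBijective g (LinearMap.bijective_of_ne_zero hg)).symm⟩⟩

theorem numIrreps_eq_card (hs : ∀ ℓ, IsSimpleModule A (RepModule (ρ ℓ)))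
    (hne : ∀ ℓ ℓ', Nonempty (RepModule (ρ ℓ) ≃ₗ[A] RepModule (ρ ℓ')) → ℓ = ℓ')
    (hex : ∀ (V : Type) [AddCommGroup V] [Module A V], IsSimpleModule A V →
      ∃ ℓ, Nonempty (V ≃ₗ[A] RepModule (ρ ℓ))) (d : ℕ) :
    numIrreps A d = Nat.card {ℓ // dim ℓ = d} := by
  -- The equation `dim ℓ = d` is eliminated here once and for all; afterwards only the isomorphism
  -- with `ρ ℓ` is used, not the transported matrices.
  have hcast : ∀ x : {ℓ // dim ℓ = d}, ∃ r : Irrep A d,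
      Nonempty (RepModule r.1 ≃ₗ[A] RepModule (ρ x.1)) := by
    rintro ⟨ℓ, rfl⟩
    exact ⟨⟨ρ ℓ, hs ℓ⟩, ⟨LinearEquiv.refl _ _⟩⟩
  choose r hr using hcast
  refine (Nat.card_congr (Equiv.ofBijective (fun x => Quotient.mk (irrepSetoid A d) (r x))
    ⟨fun x y hxy => ?_, fun q => ?_⟩)).symm
  · obtain ⟨e⟩ : Nonempty (RepModule (r x).1 ≃ₗ[A] RepModule (r y).1) := Quotient.exact hxy
    obtain ⟨ex⟩ := hr x
    obtain ⟨ey⟩ := hr y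
    exact Subtype.ext (hne _ _ ⟨ex.symm.trans (e.trans ey)⟩)
  · induction q using Quotient.inductionOn with
    | h s =>
      obtain ⟨ℓ, ⟨e⟩⟩ := hex (RepModule s.1) s.2
      obtain ⟨e'⟩ := hr ⟨ℓ, (dim_eq_of_equiv e).symm⟩
      exact ⟨⟨ℓ, (dim_eq_of_equiv e).symm⟩, Quotient.sound ⟨e'.trans e.symm⟩⟩

end

end RepModule

/-! ## Representations of the quantum double -/

namespace QuantumDouble

section

variable {G : Type*}

theorem finrank_eq [Fintype G] :
    Module.finrank ℂ (QuantumDouble G) = Nat.card G ^ 2 := by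
  have h : Module.finrank ℂ (G → G → ℂ) = Nat.card G ^ 2 := by
    rw [Module.finrank_pi_fintype]
    simp [sq]
  exact h

instance instFiniteDimensional [Finite G] : FiniteDimensional ℂ (QuantumDouble G) :=
  inferInstanceAs (FiniteDimensional ℂ (G → G → ℂ))

variable [Group G] [Fintype G] [DecidableEq G]

theorem of_one {G : Type*} [Group G] [DecidableEq G] : of (1 : G) = 1 := rfl

theorem sum_apply {ι : Type*} (t : Finset ι) (x : ι → QuantumDouble G) (g h : G) :
    (∑ i ∈ t, x i) g h = ∑ i ∈ t, x i g h := by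
  classical
  induction t using Finset.induction_on with
  | empty => rfl
  | insert i t hi ih => rw [Finset.sum_insert hi, Finset.sum_insert hi, add_apply, ih]

theorem sum_dual : ∑ h : G, dual h = 1 := ext fun x y => by
  rw [sum_apply]
  by_cases hx : x = 1 <;> simp [dual, one_apply, hx]

theorem eq_sum (x : QuantumDouble G) : x = ∑ g, ∑ h, x g h • (of g * dual h) := ext fun a b => by
  have key : ∀ g h, (x g h • (of g * dual h)) a b = x g h * if a = g ∧ b = h then 1 else 0 := by
    intro g h
    rw [smul_apply, of_mul_dual]
  simp only [sum_apply, key]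
  rw [Finset.sum_eq_single a, Finset.sum_eq_single b] <;> simp +contextual [eq_comm]

/-- The representation of `D(G)` on a representation of `G` with a basis that is homogeneous for a
compatible grading by `G`. -/
noncomputable def gradedRep {d : ℕ} (f : G →* Matrix (Fin d) (Fin d) ℂ) (s : Fin d → G)
    (hf : ∀ g i j, f g i j ≠ 0 → s i = g * s j * g⁻¹) :
    QuantumDouble G →ₐ[ℂ] Matrix (Fin d) (Fin d) ℂ :=
  AlgHom.ofLinearMap
    { toFun := fun x => Matrix.of fun i j => ∑ g, x g (s j) * f g i j
      map_add' := fun x y => by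
        ext i j
        simp [add_apply, add_mul, Finset.sum_add_distrib]
      map_smul' := fun c x => by
        ext i j
        simp [smul_apply, Finset.mul_sum, mul_assoc] }
    (by
      ext i j
      simp [one_apply])
    (fun x y => by
      ext i j
      -- Wherever `f u k j` is nonzero, the degree `s k` equals `u * s j * u⁻¹`. This is the shift
      -- of the second argument in the product of `D(G)`.
      have h1 : ∀ k, (∑ g, x g (s k) * f g i k) * (∑ u, y u (s j) * f u k j) =
          ∑ u, ∑ g, x g (u * s j * u⁻¹) * y u (s j) * (f g i k * f u k j) := by
        intro k
        rw [Finset.mul_sum]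
        refine Finset.sum_congr rfl fun u _ => ?_
        rw [Finset.sum_mul]
        refine Finset.sum_congr rfl fun g _ => ?_
        by_cases h : f u k j = 0
        · simp [h]
        · rw [hf u k j h]
          ring
      simp only [LinearMap.coe_mk, AddHom.coe_mk, Matrix.of_apply, Matrix.mul_apply, h1]
      rw [Finset.sum_comm]
      simp only [mul_apply, Finset.sum_mul]
      rw [Finset.sum_comm]
      refine Finset.sum_congr rfl fun u _ => ?_
      rw [Finset.sum_comm]
      refine Fintype.sum_equiv (Equiv.mulRight u⁻¹) _ _ fun g => ?_
      rw [← Finset.mul_sum, Equiv.coe_mulRight, ← Matrix.mul_apply, ← map_mul,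
        inv_mul_cancel_right])

theorem gradedRep_apply {d : ℕ} (f : G →* Matrix (Fin d) (Fin d) ℂ) (s : Fin d → G)
    (hf : ∀ g i j, f g i j ≠ 0 → s i = g * s j * g⁻¹) (x : QuantumDouble G) (i j : Fin d) :
    gradedRep f s hf x i j = ∑ g, x g (s j) * f g i j := rfl

theorem gradedRep_of {d : ℕ} (f : G →* Matrix (Fin d) (Fin d) ℂ) (s : Fin d → G)
    (hf : ∀ g i j, f g i j ≠ 0 → s i = g * s j * g⁻¹) (g : G) :
    gradedRep f s hf (of g) = f g := by
  ext i j
  simp [gradedRep_apply, of]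

theorem gradedRep_dual {d : ℕ} (f : G →* Matrix (Fin d) (Fin d) ℂ) (s : Fin d → G)
    (hf : ∀ g i j, f g i j ≠ 0 → s i = g * s j * g⁻¹) (h : G) :
    gradedRep f s hf (dual h) = Matrix.diagonal fun j => if h = s j then 1 else 0 := by
  ext i j
  simp only [gradedRep_apply, dual, ite_and, ite_mul, one_mul, zero_mul, Finset.sum_ite_eq',
    Finset.mem_univ, if_true, map_one, Matrix.diagonal_apply, Matrix.one_apply, eq_comm (a := h)]
  by_cases hij : i = j
  · subst hij
    simp
  · simp [hij]

end

end QuantumDouble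

/-! ## Irreducible representations are induced -/

namespace QuantumDouble

section

variable {G : Type*} [Group G] [Fintype G] [DecidableEq G] {d : ℕ}
  (ρ : QuantumDouble G →ₐ[ℂ] Matrix (Fin d) (Fin d) ℂ) (g₀ : G)

theorem mulVec_of_mul (g h : G) (v : Fin d → ℂ) :
    ρ (of (g * h)) *ᵥ v = ρ (of g) *ᵥ ρ (of h) *ᵥ v := by
  rw [← of_mul_of, map_mul, Matrix.mulVec_mulVec]

theorem dual_mulVec_of (g h : G) (v : Fin d → ℂ) :
    ρ (dual h) *ᵥ ρ (of g) *ᵥ v = ρ (of g) *ᵥ ρ (dual (g⁻¹ * h * g)) *ᵥ v := by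
  rw [Matrix.mulVec_mulVec, ← map_mul, dual_mul_of, map_mul, Matrix.mulVec_mulVec]

theorem dual_mulVec_dual (g h : G) (v : Fin d → ℂ) :
    ρ (dual g) *ᵥ ρ (dual h) *ᵥ v = if g = h then ρ (dual h) *ᵥ v else 0 := by
  rw [Matrix.mulVec_mulVec, ← map_mul, dual_mul_dual]
  split_ifs <;> simp

/-- The homogeneous component of degree `g₀`. -/
noncomputable def component : Submodule ℂ (Fin d → ℂ) :=
  LinearMap.range (Matrix.mulVecLin (ρ (dual g₀)))

theorem mem_component_iff {v : Fin d → ℂ} : v ∈ component ρ g₀ ↔ ρ (dual g₀) *ᵥ v = v := by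
  constructor
  · rintro ⟨w, rfl⟩
    simp only [Matrix.mulVecLin_apply, dual_mulVec_dual, if_true]
  · intro h
    exact ⟨v, h⟩

/-- The centraliser of `g₀` acts on the component of degree `g₀`. -/
noncomputable def componentRep :
    Representation ℂ (Subgroup.centralizer {g₀} : Subgroup G) (component ρ g₀) where
  toFun z := (Matrix.mulVecLin (ρ (of (z : G)))).restrict fun v hv => by
    rw [mem_component_iff] at hv ⊢
    have hz : (z : G)⁻¹ * g₀ * z = g₀ := by
      rw [mul_assoc, ← Subgroup.mem_centralizer_singleton_iff.mp z.2, inv_mul_cancel_left]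
    rw [Matrix.mulVecLin_apply, dual_mulVec_of, hz, hv]
  map_one' := LinearMap.ext fun v => Subtype.ext (by simp [of_one])
  map_mul' z z' := LinearMap.ext fun v => Subtype.ext (by
    simp [mulVec_of_mul])

/-- The same representation in coordinates. -/
noncomputable def coordRep :
    Representation ℂ (Subgroup.centralizer {g₀} : Subgroup G)
      (Fin (Module.finrank ℂ (component ρ g₀)) → ℂ) :=
  ((Module.finBasis ℂ (component ρ g₀)).equivFun.conjRingEquiv.toMonoidHom).comp
    (componentRep ρ g₀)

/-- The embedding of the coordinate space as the component of degree `g₀`. -/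
noncomputable def coordEmb :
    (Fin (Module.finrank ℂ (component ρ g₀)) → ℂ) →ₗ[ℂ] (Fin d → ℂ) :=
  (component ρ g₀).subtype ∘ₗ (Module.finBasis ℂ (component ρ g₀)).equivFun.symm.toLinearMap

theorem coordEmb_injective : Function.Injective (coordEmb ρ g₀) :=
  Subtype.val_injective.comp (LinearEquiv.injective _)

theorem dual_mulVec_coordEmb (v) : ρ (dual g₀) *ᵥ coordEmb ρ g₀ v = coordEmb ρ g₀ v :=
  (mem_component_iff ρ g₀).mp (Subtype.property _)

/-- Projecting to degree `g₀` lands in the component, so every such projection has coordinates. -/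
theorem exists_coordEmb_eq (w : Fin d → ℂ) : ∃ v, coordEmb ρ g₀ v = ρ (dual g₀) *ᵥ w := by
  refine ⟨(Module.finBasis ℂ (component ρ g₀)).equivFun ⟨ρ (dual g₀) *ᵥ w, w, rfl⟩, ?_⟩
  rw [coordEmb, LinearMap.comp_apply, LinearEquiv.coe_coe, LinearEquiv.symm_apply_apply]
  rfl

theorem coordEmb_coordRep (z : (Subgroup.centralizer {g₀} : Subgroup G)) (v) :
    coordEmb ρ g₀ (coordRep ρ g₀ z v) = ρ (of (z : G)) *ᵥ coordEmb ρ g₀ v := by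
  have h : coordRep ρ g₀ z v = (Module.finBasis ℂ (component ρ g₀)).equivFun
      (componentRep ρ g₀ z ((Module.finBasis ℂ (component ρ g₀)).equivFun.symm v)) := rfl
  rw [h, coordEmb, LinearMap.comp_apply, LinearEquiv.coe_coe, LinearEquiv.symm_apply_apply]
  rfl

variable {m : ℕ} (s α : Fin m → G)

/-- The map from the induced module to the given one. -/
noncomputable def inducedMap :
    (Fin m → Fin (Module.finrank ℂ (component ρ g₀)) → ℂ) →ₗ[ℂ] (Fin d → ℂ) :=
  LinearMap.lsum ℂ _ ℂ fun i => Matrix.mulVecLin (ρ (of (α i))) ∘ₗ coordEmb ρ g₀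

theorem inducedMap_apply (f : Fin m → Fin (Module.finrank ℂ (component ρ g₀)) → ℂ) :
    inducedMap ρ g₀ α f = ∑ i, ρ (of (α i)) *ᵥ coordEmb ρ g₀ (f i) := by
  simp [inducedMap]

theorem inducedMap_single (i : Fin m) (v : Fin (Module.finrank ℂ (component ρ g₀)) → ℂ) :
    inducedMap ρ g₀ α (Pi.single i v) = ρ (of (α i)) *ᵥ coordEmb ρ g₀ v := by
  rw [inducedMap_apply, Finset.sum_eq_single i] <;> simp +contextual

variable {s α}

theorem dual_mulVec_inducedMap_single (hα : ∀ i, s i = α i * g₀ * (α i)⁻¹) (h : G) (i : Fin m)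
    (v : Fin (Module.finrank ℂ (component ρ g₀)) → ℂ) :
    ρ (dual h) *ᵥ inducedMap ρ g₀ α (Pi.single i v) =
      if h = s i then inducedMap ρ g₀ α (Pi.single i v) else 0 := by
  have hiff : (α i)⁻¹ * h * α i = g₀ ↔ h = s i := by
    rw [hα, mul_assoc, inv_mul_eq_iff_eq_mul, ← eq_mul_inv_iff_mul_eq]
  rw [inducedMap_single, dual_mulVec_of, ← dual_mulVec_coordEmb, dual_mulVec_dual]
  simp only [hiff]
  split_ifs <;> simp

theorem of_mulVec_inducedMap_single (g : G) (i j : Fin m)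
    (z : (Subgroup.centralizer {g₀} : Subgroup G))
    (v : Fin (Module.finrank ℂ (component ρ g₀)) → ℂ) (hz : (z : G) = (α j)⁻¹ * g * α i) :
    ρ (of g) *ᵥ inducedMap ρ g₀ α (Pi.single i v) =
      inducedMap ρ g₀ α (Pi.single j (coordRep ρ g₀ z v)) := by
  rw [inducedMap_single, inducedMap_single, coordEmb_coordRep, ← mulVec_of_mul, ← mulVec_of_mul,
    hz, mul_assoc, mul_inv_cancel_left]

/-- The summand of index `i` has degree `s i`. As these degrees are distinct, `(s i)^*` isolates
that summand, and `α i` acts invertibly. -/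
theorem inducedMap_injective (hs : Function.Injective s)
    (hα : ∀ i, s i = α i * g₀ * (α i)⁻¹) : Function.Injective (inducedMap ρ g₀ α) := by
  rw [← LinearMap.ker_eq_bot, LinearMap.ker_eq_bot']
  intro f hf
  funext i
  have h1 : ρ (dual (s i)) *ᵥ inducedMap ρ g₀ α f = inducedMap ρ g₀ α (Pi.single i (f i)) := by
    conv_lhs => rw [← Finset.univ_sum_single f, map_sum, Matrix.mulVec_sum]
    rw [Finset.sum_eq_single i]
    · rw [dual_mulVec_inducedMap_single ρ g₀ hα, if_pos rfl]
    · intro j _ hj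
      rw [dual_mulVec_inducedMap_single ρ g₀ hα, if_neg fun h => hj (hs h).symm]
    · simp
  rw [hf, Matrix.mulVec_zero, inducedMap_single] at h1
  have h2 := congrArg (fun w => ρ (of (α i)⁻¹) *ᵥ w) h1.symm
  simp only [← mulVec_of_mul, inv_mul_cancel, of_one, map_one, Matrix.one_mulVec,
    Matrix.mulVec_zero] at h2
  exact coordEmb_injective ρ g₀ (h2.trans (map_zero _).symm)

/-- From `1 = ∑ h^*`, a vector is the sum of its homogeneous parts, and only degrees in the class
occur. The part of degree `s i` is `α i` applied to a vector of degree `g₀`. -/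
theorem inducedMap_surjective (hα : ∀ i, s i = α i * g₀ * (α i)⁻¹)
    (hs : Function.Injective s)
    (hzero : ∀ h, h ∉ Set.range s → ρ (dual h) = 0) :
    Function.Surjective (inducedMap ρ g₀ α) := by
  intro w
  have h1 : ∀ i, ∃ v, ρ (of (α i)) *ᵥ coordEmb ρ g₀ v = ρ (dual (s i)) *ᵥ w := by
    intro i
    obtain ⟨v, hv⟩ := exists_coordEmb_eq ρ g₀ (ρ (of (α i)⁻¹) *ᵥ w)
    refine ⟨v, ?_⟩
    rw [hv, dual_mulVec_of, inv_inv, ← hα, ← mulVec_of_mul, mul_inv_cancel, of_one, map_one,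
      Matrix.one_mulVec]
  choose f hf using h1
  refine ⟨f, ?_⟩
  rw [inducedMap_apply]
  simp only [hf]
  have h2 : ∑ h, ρ (dual h) *ᵥ w = w := by
    rw [← Matrix.sum_mulVec, ← map_sum, sum_dual, map_one, Matrix.one_mulVec]
  conv_rhs => rw [← h2]
  refine Finset.sum_of_injOn s hs.injOn (by simp) ?_ (by simp)
  intro h _ hh
  rw [hzero h (by simpa using hh), Matrix.zero_mulVec]

/-- The submodule of the induced module that belongs to a subrepresentation. -/
noncomputable def inducedSubmodule (hα : ∀ i, s i = α i * g₀ * (α i)⁻¹)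
    (hrange : Set.range s = {g | IsConj g₀ g}) (T : Subrepresentation (coordRep ρ g₀)) :
    Submodule (QuantumDouble G) (RepModule ρ) :=
  let N : Submodule ℂ (Fin d → ℂ) :=
    (Submodule.pi Set.univ fun _ => T.toSubmodule).map (inducedMap ρ g₀ α)
  have hsingle : ∀ i v, v ∈ T.toSubmodule → inducedMap ρ g₀ α (Pi.single i v) ∈ N := by
    intro i v hv
    refine Submodule.mem_map_of_mem ?_
    rw [Submodule.mem_pi]
    intro j _
    by_cases hj : j = i
    · subst hj
      simpa using hv
    · simp [hj]
  -- By additivity, stability under `a` may be tested on the vectors `α_i ⊗ v` with `v` in `T`.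
  have hgen : ∀ a : QuantumDouble G, (∀ i v, v ∈ T.toSubmodule →
      ρ a *ᵥ inducedMap ρ g₀ α (Pi.single i v) ∈ N) → ∀ w ∈ N, ρ a *ᵥ w ∈ N := by
    rintro a ha _ ⟨f, hf, rfl⟩
    rw [← Finset.univ_sum_single f, map_sum, Matrix.mulVec_sum]
    exact N.sum_mem fun i _ => ha i _ (hf i (Set.mem_univ i))
  have hdual : ∀ h, ∀ w ∈ N, ρ (dual h) *ᵥ w ∈ N := fun h => hgen _ fun i v hv => by
    rw [dual_mulVec_inducedMap_single ρ g₀ hα]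
    split_ifs
    · exact hsingle i v hv
    · exact N.zero_mem
  have hof : ∀ g, ∀ w ∈ N, ρ (of g) *ᵥ w ∈ N := fun g => hgen _ fun i v hv => by
    obtain ⟨j, hj⟩ : g * s i * g⁻¹ ∈ Set.range s := by
      rw [hrange]
      have h1 : IsConj g₀ (s i) := isConj_iff.mpr ⟨α i, (hα i).symm⟩
      exact h1.trans (isConj_iff.mpr ⟨g, rfl⟩)
    -- With `s j = g * s i * g⁻¹`, this element carries `g₀` to `s i`, then to `s j`, then back to
    -- `g₀` under conjugation, so it centralises `g₀`.
    have hz : (α j)⁻¹ * g * α i ∈ (Subgroup.centralizer {g₀} : Subgroup G) := by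
      rw [Subgroup.mem_centralizer_singleton_iff]
      rw [hα, hα] at hj
      calc (α j)⁻¹ * g * α i * g₀ =
            (α j)⁻¹ * (g * (α i * g₀ * (α i)⁻¹) * g⁻¹) * α j * ((α j)⁻¹ * g * α i) := by group
        _ = g₀ * ((α j)⁻¹ * g * α i) := by rw [← hj]; group
    rw [of_mulVec_inducedMap_single ρ g₀ g i j ⟨_, hz⟩ v rfl]
    exact hsingle j _ (T.apply_mem_toSubmodule _ hv)
  { carrier := {w | RepModule.toVec ρ w ∈ N}
    add_mem' := fun hv hw => N.add_mem hv hw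
    zero_mem' := N.zero_mem
    smul_mem' := fun a w hw => by
      -- The elements `g h^*` span `D(G)`, so stability under all `g` and all `h^*` suffices.
      have ha : RepModule.toVec ρ (a • w) = ∑ g, ∑ h, a g h • (ρ (of g) *ᵥ ρ (dual h) *ᵥ
          RepModule.toVec ρ w) := by
        rw [RepModule.toVec_smul]
        conv_lhs => rw [eq_sum a]
        simp only [map_sum, Matrix.sum_mulVec, map_smul, Matrix.smul_mulVec, map_mul,
          Matrix.mulVec_mulVec]
      change RepModule.toVec ρ (a • w) ∈ N
      rw [ha]
      exact N.sum_mem fun g _ => N.sum_mem fun h _ => N.smul_mem _ (hof _ _ (hdual _ _ hw)) }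

theorem mem_inducedSubmodule (hα : ∀ i, s i = α i * g₀ * (α i)⁻¹)
    (hrange : Set.range s = {g | IsConj g₀ g}) (T : Subrepresentation (coordRep ρ g₀))
    (w : RepModule ρ) : w ∈ inducedSubmodule ρ g₀ hα hrange T ↔
      ∃ f, (∀ i, f i ∈ T.toSubmodule) ∧ inducedMap ρ g₀ α f = RepModule.toVec ρ w := by
  change RepModule.toVec ρ w ∈
    (Submodule.pi Set.univ fun _ => T.toSubmodule).map (inducedMap ρ g₀ α) ↔ _
  simp [Submodule.mem_map, Submodule.mem_pi]

/-- An irreducible representation of `D(G)` that is supported on the conjugacy class of `g₀` is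
induced from an irreducible representation of the centraliser. -/
theorem exists_isInducedFrom (hρ : IsSimpleModule (QuantumDouble G) (RepModule ρ))
    (hα : ∀ i, s i = α i * g₀ * (α i)⁻¹) (hs : Function.Injective s)
    (hrange : Set.range s = {g | IsConj g₀ g})
    (hzero : ∀ h, ¬ IsConj g₀ h → ρ (dual h) = 0) :
    ∃ (q : ℕ) (π : Representation ℂ (Subgroup.centralizer {g₀} : Subgroup G) (Fin q → ℂ)),
      π.IsIrreducible ∧ IsInducedFrom ρ g₀ s α π := by
  have hinj := inducedMap_injective ρ g₀ hs hα
  have hsurj := inducedMap_surjective ρ g₀ hα hs fun h hh => hzero h (by rwa [hrange] at hh)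
  refine ⟨_, coordRep ρ g₀, ?_, LinearEquiv.ofBijective _ ⟨hinj, hsurj⟩, ?_, ?_⟩
  -- Only the existence of some index matters below.
  · obtain ⟨i₀, -⟩ : g₀ ∈ Set.range s := by
      rw [hrange]
      exact IsConj.refl g₀
    have hnt : Nontrivial (Fin (Module.finrank ℂ (component ρ g₀)) → ℂ) := by
      by_contra h
      rw [not_nontrivial_iff_subsingleton] at h
      have h1 : Nontrivial (Fin d → ℂ) := IsSimpleModule.nontrivial (QuantumDouble G) (RepModule ρ)
      have h2 : Subsingleton (Fin d → ℂ) := hsurj.subsingleton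
      exact not_nontrivial _ h1
    refine { exists_pair_ne := ⟨⊥, ⊤, fun h => ?_⟩, eq_bot_or_eq_top := fun T => ?_ }
    · exact bot_ne_top (congrArg Subrepresentation.toSubmodule h)
    -- The submodule induced by `T` is zero or everything; since `inducedMap` is injective, reading
    -- off the coordinate `i₀` transfers this to `T`.
    · rcases eq_bot_or_eq_top (inducedSubmodule ρ g₀ hα hrange T) with h | h
      · left
        refine Subrepresentation.toSubmodule_injective ((Submodule.eq_bot_iff _).mpr ?_)
        intro v hv
        have hmem : (RepModule.toVec ρ).symm (inducedMap ρ g₀ α (Pi.single i₀ v)) ∈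
            inducedSubmodule ρ g₀ hα hrange T := by
          rw [mem_inducedSubmodule]
          refine ⟨Pi.single i₀ v, fun i => ?_, by simp⟩
          by_cases hi : i = i₀
          · subst hi
            simpa using hv
          · simp [hi]
        rw [h, Submodule.mem_bot, LinearEquiv.map_eq_zero_iff] at hmem
        simpa using hinj (hmem.trans (map_zero _).symm)
      · right
        refine Subrepresentation.toSubmodule_injective (Submodule.eq_top_iff'.mpr ?_)
        intro v
        have hmem : (RepModule.toVec ρ).symm (inducedMap ρ g₀ α (Pi.single i₀ v)) ∈
            inducedSubmodule ρ g₀ hα hrange T := by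
          rw [h]
          exact Submodule.mem_top
        rw [mem_inducedSubmodule] at hmem
        obtain ⟨f, hf, hfv⟩ := hmem
        rw [LinearEquiv.apply_symm_apply] at hfv
        have := hf i₀
        rwa [hinj hfv, Pi.single_eq_same] at this
  · intro g i j z v _ hz
    exact of_mulVec_inducedMap_single ρ g₀ g i j z v hz
  · intro h i v
    exact dual_mulVec_inducedMap_single ρ g₀ hα h i v

end

end QuantumDouble

/-! ## Conjugacy classes of the dihedral group -/

namespace DihedralDouble

open DihedralGroup

section

variable {n : ℕ}

theorem σ_pow (k : ℕ) : σ n ^ k = r (k : ZMod n) := r_one_pow k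

theorem σ_pow_mul_τ (k : ℕ) : σ n ^ k * τ n = sr (-(k : ZMod n)) := by
  rw [σ_pow, τ, r_mul_sr, zero_sub]

theorem two_mul_half (hn : Even n) : 2 * (n / 2) = n := Nat.two_mul_div_two_of_even hn

theorem natCast_eq_zero_iff_of_lt {k : ℕ} (hk : k < n) : (k : ZMod n) = 0 ↔ k = 0 := by
  rw [ZMod.natCast_eq_zero_iff]
  exact ⟨fun h => Nat.eq_zero_of_dvd_of_lt h hk, fun h => h ▸ dvd_zero n⟩

theorem natCast_inj_of_lt {k l : ℕ} (hk : k < n) (hl : l < n) :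
    (k : ZMod n) = l ↔ k = l := by
  rw [ZMod.natCast_eq_natCast_iff', Nat.mod_eq_of_lt hk, Nat.mod_eq_of_lt hl]

theorem half_add_half (hn : Even n) : ((n / 2 : ℕ) : ZMod n) + ((n / 2 : ℕ) : ZMod n) = 0 := by
  rw [← Nat.cast_add, ← two_mul, two_mul_half hn, ZMod.natCast_self]

theorem neg_half (hn : Even n) : -((n / 2 : ℕ) : ZMod n) = ((n / 2 : ℕ) : ZMod n) :=
  neg_eq_of_add_eq_zero_left (half_add_half hn)

theorem add_self_eq_zero_iff [NeZero n] (hn : Even n) (x : ZMod n) :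
    x + x = 0 ↔ x = 0 ∨ x = ((n / 2 : ℕ) : ZMod n) := by
  constructor
  · intro h
    have hx := ZMod.val_lt x
    have h2 := two_mul_half hn
    rw [← ZMod.natCast_zmod_val x] at h ⊢
    rw [← Nat.cast_add, ZMod.natCast_eq_zero_iff] at h
    obtain ⟨c, hc⟩ := h
    -- Here `2 * x.val = n * c` with `x.val < n`, so `c` is `0` or `1`: the two solutions.
    have hc2 : c < 2 := by
      by_contra! h3
      have := Nat.mul_le_mul_left n h3
      omega
    interval_cases c
    · left
      rw [show x.val = 0 by omega, Nat.cast_zero]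
    · right
      rw [show x.val = n / 2 by omega]
  · rintro (rfl | rfl)
    · exact add_zero 0
    · exact half_add_half hn

theorem add_self_ne_zero_of_halfRange (hn : Even n) (k : HalfRange n) :
    ((k.val : ℕ) : ZMod n) + ((k.val : ℕ) : ZMod n) ≠ 0 := by
  have h1 := k.val.2
  have h2 := k.2
  have h3 := two_mul_half hn
  rw [← Nat.cast_add, Ne, natCast_eq_zero_iff_of_lt (by omega)]
  omega

/-- Parity is well defined modulo an even `n`. This is what keeps the two classes of reflections
apart. -/
theorem add_self_ne_one [NeZero n] (hn : Even n) (x : ZMod n) : x + x ≠ 1 := by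
  intro h
  rw [← ZMod.natCast_zmod_val x, ← Nat.cast_add, ← Nat.cast_one, ZMod.natCast_eq_natCast_iff] at h
  have := (h.of_dvd hn.two_dvd)
  unfold Nat.ModEq at this
  omega

theorem isConj_r_iff (x : ZMod n) (g : DihedralGroup n) :
    IsConj (r x) g ↔ g = r x ∨ g = r (-x) := by
  rw [isConj_iff]
  constructor
  · rintro ⟨c | c, rfl⟩
    · left
      simp
    · right
      simp
  · rintro (rfl | rfl)
    · exact ⟨1, by simp⟩
    · exact ⟨sr 0, by simp⟩

theorem isConj_sr_iff (x : ZMod n) (g : DihedralGroup n) :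
    IsConj (sr x) g ↔ ∃ c, g = sr (x + (c + c)) := by
  rw [isConj_iff]
  constructor
  · rintro ⟨c | c, rfl⟩
    · exact ⟨-c, by simp only [inv_r, r_mul_sr, sr_mul_r]; ring_nf⟩
    -- Conjugating `sr x` by `sr c` gives `sr (2c - x)`, and `2c - x = x + 2(c - x)`.
    · exact ⟨c - x, by simp only [inv_sr, sr_mul_sr, r_mul_sr]; ring_nf⟩
  · rintro ⟨c, rfl⟩
    exact ⟨r (-c), by simp only [inv_r, r_mul_sr, sr_mul_r]; ring_nf⟩

/-- Doubling turns congruence modulo `n/2` into congruence modulo `n`, so an even residue has a half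
in the range `0 ≤ i < n/2` of the class lists. -/
theorem exists_half_add_self [NeZero n] (hn : Even n) (c : ZMod n) :
    ∃ i : Fin (n / 2), ((2 * (i : ℕ) : ℕ) : ZMod n) = c + c := by
  have h2 := two_mul_half hn
  have hpos := NeZero.pos n
  refine ⟨⟨c.val % (n / 2), Nat.mod_lt _ (by omega)⟩, ?_⟩
  conv_rhs => rw [← ZMod.natCast_zmod_val c, ← Nat.cast_add, ← two_mul]
  rw [ZMod.natCast_eq_natCast_iff]
  change 2 * (c.val % (n / 2)) ≡ 2 * c.val [MOD n]
  have h := Nat.ModEq.mul_left' 2 (Nat.mod_modEq c.val (n / 2))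
  rwa [h2] at h

/-! ### The table of classes, centralisers and conjugating elements -/

namespace ClassLabel

theorem elem_injective (hn : Even n) (c : ClassLabel n) : Function.Injective c.elem := by
  have h2 := two_mul_half hn
  cases c with
  | one => exact Function.injective_of_subsingleton (α := Fin 1) _
  | central => exact Function.injective_of_subsingleton (α := Fin 1) _
  | rot k =>
    have hk := add_self_ne_zero_of_halfRange hn k
    have hne : σ n ^ (k.val : ℕ) ≠ (σ n ^ (k.val : ℕ))⁻¹ := by
      rw [σ_pow, inv_r]
      intro h
      exact hk (eq_neg_iff_add_eq_zero.mp (r.inj h))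
    change Function.Injective (![σ n ^ (k.val : ℕ), (σ n ^ (k.val : ℕ))⁻¹] : Fin 2 → _)
    intro i j hij
    fin_cases i <;> fin_cases j
    · rfl
    · exact absurd hij hne
    · exact absurd hij.symm hne
    · rfl
  | reflEven =>
    intro (i : Fin (n / 2)) (j : Fin (n / 2)) hij
    have h : σ n ^ (2 * (i : ℕ)) * τ n = σ n ^ (2 * (j : ℕ)) * τ n := hij
    rw [σ_pow_mul_τ, σ_pow_mul_τ, sr.injEq, neg_inj,
      natCast_inj_of_lt (by omega) (by omega)] at h
    exact Fin.ext (by omega)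
  | reflOdd =>
    intro (i : Fin (n / 2)) (j : Fin (n / 2)) hij
    have h : σ n ^ (2 * (i : ℕ) + 1) * τ n = σ n ^ (2 * (j : ℕ) + 1) * τ n := hij
    rw [σ_pow_mul_τ, σ_pow_mul_τ, sr.injEq, neg_inj,
      natCast_inj_of_lt (by omega) (by omega)] at h
    exact Fin.ext (by omega)

theorem range_elem [NeZero n] (hn : Even n) (c : ClassLabel n) :
    Set.range c.elem = {g | IsConj c.rep g} := by
  cases c with
  | one =>
    change Set.range (fun _ : Fin 1 => (1 : DihedralGroup n)) = {g | IsConj 1 g}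
    ext g
    simp [eq_comm]
  | central =>
    change Set.range (fun _ : Fin 1 => σ n ^ (n / 2)) = {g | IsConj (σ n ^ (n / 2)) g}
    ext g
    rw [σ_pow, Set.mem_ofPred_eq, isConj_r_iff, neg_half hn]
    simp
  | rot k =>
    change Set.range (![σ n ^ (k.val : ℕ), (σ n ^ (k.val : ℕ))⁻¹] : Fin 2 → _) =
      {g | IsConj (σ n ^ (k.val : ℕ)) g}
    ext g
    rw [σ_pow, Set.mem_ofPred_eq, isConj_r_iff, inv_r]
    simp [or_comm]
  | reflEven =>
    change Set.range (fun i : Fin (n / 2) => σ n ^ (2 * (i : ℕ)) * τ n) = {g | IsConj (τ n) g}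
    ext g
    rw [τ, Set.mem_ofPred_eq, isConj_sr_iff]
    constructor
    · rintro ⟨i, rfl⟩
      refine ⟨-(i : ℕ), ?_⟩
      change σ n ^ (2 * (i : ℕ)) * τ n = _
      rw [σ_pow_mul_τ]
      push_cast
      ring_nf
    · rintro ⟨c, rfl⟩
      obtain ⟨i, hi⟩ := exists_half_add_self hn (-c)
      refine ⟨i, ?_⟩
      change σ n ^ (2 * (i : ℕ)) * τ n = _
      rw [σ_pow_mul_τ, hi]
      ring_nf
  | reflOdd =>
    change Set.range (fun i : Fin (n / 2) => σ n ^ (2 * (i : ℕ) + 1) * τ n) =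
      {g | IsConj (σ n * τ n) g}
    ext g
    have h1 : σ n * τ n = sr (-1) := by simp [σ, τ]
    rw [h1, Set.mem_ofPred_eq, isConj_sr_iff]
    constructor
    · rintro ⟨i, rfl⟩
      refine ⟨-(i : ℕ), ?_⟩
      change σ n ^ (2 * (i : ℕ) + 1) * τ n = _
      rw [σ_pow_mul_τ]
      push_cast
      ring_nf
    · rintro ⟨c, rfl⟩
      obtain ⟨i, hi⟩ := exists_half_add_self hn (-c)
      refine ⟨i, ?_⟩
      change σ n ^ (2 * (i : ℕ) + 1) * τ n = _
      rw [σ_pow_mul_τ, Nat.cast_add, hi]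
      push_cast
      ring_nf

theorem centralizer_rep [NeZero n] (hn : Even n) (c : ClassLabel n) :
    ((Subgroup.centralizer {c.rep} : Subgroup (DihedralGroup n)) : Set (DihedralGroup n)) =
      c.centraliser := by
  ext g
  rw [SetLike.mem_coe, Subgroup.mem_centralizer_singleton_iff]
  cases c with
  | one => simp [rep, centraliser]
  | central =>
    simp only [rep, centraliser, σ_pow, Set.mem_univ, iff_true]
    rcases g with x | x
    · simp [add_comm]
    · rw [sr_mul_r, r_mul_sr, sub_eq_add_neg, neg_half hn]
  | rot k =>
    simp only [rep, centraliser, σ_pow, Set.mem_ofPred_eq]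
    rcases g with x | x
    · rw [r_mul_r, r_mul_r, add_comm]
      simp only [true_iff]
      exact ⟨x.val, ZMod.val_lt x, by rw [ZMod.natCast_zmod_val]⟩
    · rw [sr_mul_r, r_mul_sr, sr.injEq]
      constructor
      · intro h
        refine absurd ?_ (add_self_ne_zero_of_halfRange hn k)
        linear_combination h
      · rintro ⟨i, -, h⟩
        cases h
  | reflEven =>
    simp only [rep, centraliser, Set.mem_insert_iff, Set.mem_singleton_iff, σ_pow_mul_τ]
    simp only [σ_pow, τ, neg_half hn]
    rcases g with x | x
    · rw [r_mul_sr, sr_mul_r, sr.injEq, one_def]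
      simp only [r.injEq, reduceCtorEq, false_or, or_false]
      rw [← add_self_eq_zero_iff hn]
      constructor <;> intro h <;> linear_combination -h
    · rw [sr_mul_sr, sr_mul_sr, r.injEq, one_def]
      simp only [sr.injEq, reduceCtorEq, false_or]
      rw [← add_self_eq_zero_iff hn]
      constructor <;> intro h <;> linear_combination -h
  | reflOdd =>
    simp only [rep, centraliser, Set.mem_insert_iff, Set.mem_singleton_iff, σ_pow_mul_τ]
    have h1 : σ n * τ n = sr (-1) := by simp [σ, τ]
    rw [h1, σ_pow, Nat.cast_add, neg_add, neg_half hn, Nat.cast_one]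
    rcases g with x | x
    · rw [r_mul_sr, sr_mul_r, sr.injEq, one_def]
      simp only [r.injEq, reduceCtorEq, false_or, or_false]
      rw [← add_self_eq_zero_iff hn]
      constructor <;> intro h <;> linear_combination -h
    · rw [sr_mul_sr, sr_mul_sr, r.injEq, one_def]
      simp only [sr.injEq, reduceCtorEq, false_or]
      have h2 : x = ((n / 2 : ℕ) : ZMod n) + -1 ↔ x + 1 = ((n / 2 : ℕ) : ZMod n) := by
        rw [← sub_eq_add_neg, eq_sub_iff_add_eq]
      rw [h2, eq_neg_iff_add_eq_zero, ← add_self_eq_zero_iff hn]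
      constructor <;> intro h <;> linear_combination -h

theorem elem_eq_conj (c : ClassLabel n) (i) :
    c.elem i = c.alpha i * c.rep * (c.alpha i)⁻¹ := by
  cases c with
  | one => simp [elem, alpha, rep]
  | central => simp [elem, alpha, rep]
  | rot k =>
    change Fin 2 at i
    fin_cases i
    · change σ n ^ (k.val : ℕ) = 1 * σ n ^ (k.val : ℕ) * 1⁻¹
      simp
    · change (σ n ^ (k.val : ℕ))⁻¹ = τ n * σ n ^ (k.val : ℕ) * (τ n)⁻¹
      simp [σ_pow, τ]
  | reflEven =>
    change σ n ^ (2 * (i : ℕ)) * τ n = σ n ^ (i : ℕ) * τ n * (σ n ^ (i : ℕ))⁻¹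
    rw [σ_pow_mul_τ, σ_pow_mul_τ, σ_pow, inv_r, sr_mul_r]
    push_cast
    ring_nf
  | reflOdd =>
    change σ n ^ (2 * (i : ℕ) + 1) * τ n = σ n ^ (i : ℕ) * (σ n * τ n) * (σ n ^ (i : ℕ))⁻¹
    rw [σ_pow_mul_τ, ← mul_assoc, ← pow_succ, σ_pow_mul_τ, σ_pow, inv_r, sr_mul_r]
    push_cast
    ring_nf

theorem alpha_eq_one (hn : Even n) (c : ClassLabel n) (i) (h : c.elem i = c.rep) :
    c.alpha i = 1 := by
  have h2 := two_mul_half hn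
  cases c with
  | one => rfl
  | central => rfl
  | rot k =>
    change Fin 2 at i
    fin_cases i
    · rfl
    · have h' : (σ n ^ (k.val : ℕ))⁻¹ = σ n ^ (k.val : ℕ) := h
      rw [σ_pow, inv_r, r.injEq, neg_eq_iff_add_eq_zero] at h'
      exact absurd h' (add_self_ne_zero_of_halfRange hn k)
  | reflEven =>
    change Fin (n / 2) at i
    have h' : σ n ^ (2 * (i : ℕ)) * τ n = sr 0 := h
    rw [σ_pow_mul_τ, sr.injEq, neg_eq_zero, natCast_eq_zero_iff_of_lt (by omega)] at h'
    change σ n ^ (i : ℕ) = 1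
    rw [show (i : ℕ) = 0 by omega, pow_zero]
  | reflOdd =>
    change Fin (n / 2) at i
    have h' : σ n ^ (2 * (i : ℕ) + 1) * τ n = σ n ^ 1 * τ n := by
      rw [pow_one]
      exact h
    have hi := i.isLt
    rw [σ_pow_mul_τ, σ_pow_mul_τ, sr.injEq, neg_inj,
      natCast_inj_of_lt (l := 1) (by omega) (by omega)] at h'
    change σ n ^ (i : ℕ) = 1
    rw [show (i : ℕ) = 0 by omega, pow_zero]

/-- Conjugate rotations have equal or opposite exponents. In the range `0, …, n/2` opposite
exponents are equal, since `a + b ≤ n` can be divisible by `n` only at the two ends. -/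
theorem eq_of_isConj_r (hn : Even n) {a b : ℕ} (ha : a ≤ n / 2) (hb : b ≤ n / 2)
    (h : IsConj (σ n ^ a) (σ n ^ b)) [NeZero n] : a = b := by
  have h2 := two_mul_half hn
  have hpos := NeZero.pos n
  rw [σ_pow, σ_pow, isConj_r_iff, r.injEq, r.injEq] at h
  rcases h with h | h
  · rw [natCast_inj_of_lt (by omega) (by omega)] at h
    exact h.symm
  · rw [eq_neg_iff_add_eq_zero, ← Nat.cast_add, ZMod.natCast_eq_zero_iff] at h
    rcases Nat.eq_zero_or_pos (b + a) with h0 | h0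
    · omega
    · have := Nat.le_of_dvd h0 h
      omega

theorem eq_of_isConj_rep [NeZero n] (hn : Even n) (c c' : ClassLabel n)
    (h : IsConj c.rep c'.rep) : c = c' := by
  have h2 := two_mul_half hn
  have hpos := NeZero.pos n
  have hrot : ∀ a : ℕ, a ≤ n / 2 → ∀ b : ℕ, b ≤ n / 2 → IsConj (σ n ^ a) (σ n ^ b) → a = b :=
    fun a ha b hb h => eq_of_isConj_r hn ha hb h
  have hmix : ∀ (a : ℕ) (x : ZMod n), ¬ IsConj (σ n ^ a) (sr x) := by
    intro a x h
    rw [σ_pow, isConj_r_iff] at h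
    rcases h with h | h <;> cases h
  have hrefl : ¬ IsConj (sr 0) (sr (-1) : DihedralGroup n) := by
    intro h
    rw [isConj_sr_iff] at h
    obtain ⟨x, hx⟩ := h
    apply add_self_ne_one hn (-x)
    rw [sr.injEq] at hx
    linear_combination hx
  have hστ : σ n * τ n = sr (-1) := by simp [σ, τ]
  -- The rotation classes are encoded by exponents: `0` for `one`, `n/2` for `central`, and those
  -- strictly between for `rot`.
  have key : ∀ c : ClassLabel n, (∃ a : ℕ, a ≤ n / 2 ∧ c.rep = σ n ^ a ∧
      (c = one ∧ a = 0 ∨ c = central ∧ a = n / 2 ∨ ∃ k, c = rot k ∧ a = k.val)) ∨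
      (c = reflEven ∧ c.rep = sr 0) ∨ (c = reflOdd ∧ c.rep = sr (-1)) := by
    intro c
    cases c with
    | one => exact Or.inl ⟨0, by omega, by simp [rep], by simp⟩
    | central => exact Or.inl ⟨n / 2, le_rfl, rfl, by simp⟩
    | rot k => exact Or.inl ⟨k.val, k.val.2.le, rfl, by simp⟩
    | reflEven => exact Or.inr (Or.inl ⟨rfl, rfl⟩)
    | reflOdd => exact Or.inr (Or.inr ⟨rfl, hστ⟩)
  rcases key c with ⟨a, ha, hra, hca⟩ | ⟨rfl, hra⟩ | ⟨rfl, hra⟩ <;>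
    rcases key c' with ⟨b, hb, hrb, hcb⟩ | ⟨rfl, hrb⟩ | ⟨rfl, hrb⟩ <;> simp only [hra, hrb] at h
  · have hab := hrot a ha b hb h
    subst hab
    rcases hca with ⟨rfl, h3⟩ | ⟨rfl, h3⟩ | ⟨k, rfl, h3⟩ <;>
      rcases hcb with ⟨rfl, h4⟩ | ⟨rfl, h4⟩ | ⟨l, rfl, h4⟩
    · rfl
    · omega
    · have := l.2
      omega
    · omega
    · rfl
    · have := l.val.2
      omega
    · have := k.2
      omega
    · have := k.val.2
      omega
    · rw [Subtype.ext (Fin.ext (h3.symm.trans h4))]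
  · exact absurd h (hmix _ _)
  · exact absurd h (hmix _ _)
  · exact absurd h.symm (hmix _ _)
  · rfl
  · exact absurd h hrefl
  · exact absurd h.symm (hmix _ _)
  · exact absurd h.symm hrefl
  · rfl

theorem exists_isConj_rep [NeZero n] (hn : Even n) (g : DihedralGroup n) :
    ∃ c : ClassLabel n, IsConj c.rep g := by
  have h2 := two_mul_half hn
  have hpos := NeZero.pos n
  rcases g with x | x
  · have hx := ZMod.val_lt x
    by_cases h0 : x.val = 0
    · refine ⟨one, ?_⟩
      rw [(ZMod.val_eq_zero x).mp h0]
      exact IsConj.refl 1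
    by_cases h1 : x.val < n / 2
    · refine ⟨rot ⟨⟨x.val, h1⟩, by change 1 ≤ x.val; omega⟩, ?_⟩
      change IsConj (σ n ^ x.val) (r x)
      rw [σ_pow, ZMod.natCast_zmod_val]
    by_cases h3 : x.val = n / 2
    · refine ⟨central, ?_⟩
      change IsConj (σ n ^ (n / 2)) (r x)
      rw [σ_pow, ← h3, ZMod.natCast_zmod_val]
    -- An exponent above `n/2` is replaced by its negative, which gives a conjugate rotation.
    · refine ⟨rot ⟨⟨n - x.val, by omega⟩, by change 1 ≤ n - x.val; omega⟩, ?_⟩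
      change IsConj (σ n ^ (n - x.val)) (r x)
      rw [σ_pow, isConj_r_iff, Nat.cast_sub hx.le, ZMod.natCast_self, ZMod.natCast_zmod_val]
      right
      simp
  · rcases Nat.even_or_odd' x.val with ⟨k, hk | hk⟩
    · refine ⟨reflEven, ?_⟩
      change IsConj (sr 0) (sr x)
      rw [isConj_sr_iff]
      refine ⟨k, ?_⟩
      conv_lhs => rw [← ZMod.natCast_zmod_val x, hk]
      push_cast
      ring_nf
    · refine ⟨reflOdd, ?_⟩
      have hστ : σ n * τ n = sr (-1) := by simp [σ, τ]
      change IsConj (σ n * τ n) (sr x)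
      rw [hστ, isConj_sr_iff]
      refine ⟨k + 1, ?_⟩
      conv_lhs => rw [← ZMod.natCast_zmod_val x, hk]
      push_cast
      ring_nf

theorem bijective_mk_rep [NeZero n] (hn : Even n) :
    Function.Bijective fun c : ClassLabel n => ConjClasses.mk c.rep := by
  refine ⟨fun c c' h => eq_of_isConj_rep hn c c' (ConjClasses.mk_eq_mk_iff_isConj.mp h), ?_⟩
  intro q
  induction q using Quotient.inductionOn with
  | h g =>
    obtain ⟨c, hc⟩ := exists_isConj_rep hn g
    exact ⟨c, ConjClasses.mk_eq_mk_iff_isConj.mpr hc⟩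

end ClassLabel

end

end DihedralDouble

/-! ## Matrices satisfying the dihedral relations -/

section

variable {M : Type*} [Monoid M] {n : ℕ}

/-- The relation `τσ = σ⁻¹τ` is used in the form `STS = T`, which needs no inverses and so makes
sense for matrices in a monoid. -/
theorem pow_mul_mul_pow_of_mul_mul_eq {S T : M} (h : S * T * S = T) (k : ℕ) :
    S ^ k * T * S ^ k = T := by
  induction k with
  | zero => simp
  | succ k ih =>
    calc S ^ (k + 1) * T * S ^ (k + 1) = (S ^ k * S) * T * (S * S ^ k) := by
          rw [← pow_succ, ← pow_succ']
      _ = S ^ k * (S * T * S) * S ^ k := by simp only [mul_assoc]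
      _ = T := by rw [h, ih]

theorem pow_val_add [NeZero n] {S : M} (hS : S ^ n = 1) (x y : ZMod n) :
    S ^ (x + y).val = S ^ x.val * S ^ y.val := by
  rw [ZMod.val_add, ← pow_add, ← pow_eq_pow_mod _ hS]

/-- The homomorphism from the dihedral group given by the images of the generators. -/
def DihedralGroup.homOfRelations [NeZero n] (S T : M) (hS : S ^ n = 1) (hT : T * T = 1)
    (hST : S * T * S = T) : DihedralGroup n →* M where
  toFun
    | .r x => S ^ x.val
    | .sr x => T * S ^ x.val
  map_one' := by
    rw [DihedralGroup.one_def]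
    simp
  map_mul' := by
    have key : ∀ x y : ZMod n, S ^ x.val * T * S ^ y.val = T * S ^ (y - x).val := by
      intro x y
      -- Splitting `S ^ y` as `S ^ x * S ^ (y - x)` lets the relation absorb both copies of `S ^ x`.
      conv_lhs => rw [← add_sub_cancel x y, pow_val_add hS, ← mul_assoc,
        pow_mul_mul_pow_of_mul_mul_eq hST]
    rintro (x | x) (y | y)
    · exact pow_val_add hS x y
    · exact ((mul_assoc _ _ _).symm.trans (key x y)).symm
    · change T * S ^ (x + y).val = T * S ^ x.val * S ^ y.val
      rw [pow_val_add hS, mul_assoc]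
    · change S ^ (y - x).val = T * S ^ x.val * (T * S ^ y.val)
      rw [mul_assoc, ← mul_assoc _ T, key, ← mul_assoc, hT, one_mul]

end

theorem Matrix.exists_of_mul_apply_ne_zero {d : ℕ} {M N : Matrix (Fin d) (Fin d) ℂ} {i j : Fin d}
    (h : (M * N) i j ≠ 0) : ∃ k, M i k ≠ 0 ∧ N k j ≠ 0 := by
  rw [Matrix.mul_apply] at h
  obtain ⟨k, -, hk⟩ := Finset.exists_ne_zero_of_sum_ne_zero h
  exact ⟨k, left_ne_zero_of_mul hk, right_ne_zero_of_mul hk⟩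

/-- A nonzero entry of a product comes from a path of nonzero entries of the factors, along which
the conjugations compose. Hence the generators suffice. -/
theorem DihedralGroup.homOfRelations_compatible {n d : ℕ} [NeZero n]
    {S T : Matrix (Fin d) (Fin d) ℂ} (hS : S ^ n = 1) (hT : T * T = 1) (hST : S * T * S = T)
    {s : Fin d → DihedralGroup n}
    (h₁ : ∀ i j, S i j ≠ 0 → s i = r 1 * s j * (r 1)⁻¹)
    (h₂ : ∀ i j, T i j ≠ 0 → s i = sr 0 * s j * (sr 0)⁻¹) (g : DihedralGroup n) (i j : Fin d)
    (h : homOfRelations S T hS hT hST g i j ≠ 0) : s i = g * s j * g⁻¹ := by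
  have hpow : ∀ (k : ℕ) (i j : Fin d), (S ^ k) i j ≠ 0 → s i = r 1 ^ k * s j * (r 1 ^ k)⁻¹ := by
    intro k
    induction k with
    | zero =>
      intro i j hij
      have : i = j := by
        by_contra hne
        exact hij (by rw [pow_zero, Matrix.one_apply_ne hne])
      simp [this]
    | succ k ih =>
      intro i j hij
      rw [pow_succ] at hij
      obtain ⟨l, h3, h4⟩ := Matrix.exists_of_mul_apply_ne_zero hij
      rw [ih i l h3, h₁ l j h4, pow_succ, mul_inv_rev]
      simp only [mul_assoc]
  have hr : ∀ (x : ZMod n) (i j : Fin d), (S ^ x.val) i j ≠ 0 →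
      s i = r x * s j * (r x)⁻¹ := by
    intro x i j hij
    have := hpow _ i j hij
    rwa [r_one_pow, ZMod.natCast_zmod_val] at this
  rcases g with x | x
  · exact hr x i j h
  · obtain ⟨l, h3, h4⟩ := Matrix.exists_of_mul_apply_ne_zero (M := T) (N := S ^ x.val) h
    have hx : sr x = sr 0 * r x := by simp
    rw [h₂ i l h3, hr x l j h4, hx, mul_inv_rev]
    simp only [mul_assoc]

/-! ### Matrices of size one and two -/

theorem signMat_mul_self (a : ℕ) : (!![(-1) ^ a] * !![(-1) ^ a] : Matrix (Fin 1) (Fin 1) ℂ) = 1 := by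
  ext i j
  fin_cases i
  fin_cases j
  simp [Matrix.mul_apply, ← mul_pow]

theorem signMat_pow {n : ℕ} (hn : Even n) (a : ℕ) :
    (!![(-1) ^ a] : Matrix (Fin 1) (Fin 1) ℂ) ^ n = 1 := by
  obtain ⟨m, rfl⟩ := hn
  rw [← two_mul, pow_mul, sq, signMat_mul_self, one_pow]

theorem signMat_mul_signMat_mul_signMat (a b : ℕ) :
    (!![(-1) ^ a] * !![(-1) ^ b] * !![(-1) ^ a] : Matrix (Fin 1) (Fin 1) ℂ) = !![(-1) ^ b] := by
  ext i j
  fin_cases i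
  fin_cases j
  simp only [Matrix.mul_apply, Finset.univ_unique, Finset.sum_singleton, Fin.zero_eta,
    Fin.default_eq_zero, Matrix.of_apply, Matrix.cons_val', Matrix.cons_val_fin_one]
  rw [mul_comm, ← mul_assoc, ← mul_pow]
  simp

theorem rotMat_pow (w : ℂ) (k : ℕ) :
    (!![w, 0; 0, w⁻¹] : Matrix (Fin 2) (Fin 2) ℂ) ^ k = !![w ^ k, 0; 0, (w ^ k)⁻¹] := by
  induction k with
  | zero => simp [Matrix.one_fin_two]
  | succ k ih => simp [pow_succ, ih, mul_comm]

theorem rotMat_pow_eq_one {w : ℂ} {n : ℕ} (hw : w ^ n = 1) :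
    (!![w, 0; 0, w⁻¹] : Matrix (Fin 2) (Fin 2) ℂ) ^ n = 1 := by
  rw [rotMat_pow, hw, inv_one, Matrix.one_fin_two]

theorem swapMat_mul_self :
    (!![0, 1; 1, 0] * !![0, 1; 1, 0] : Matrix (Fin 2) (Fin 2) ℂ) = 1 := by
  simp [Matrix.one_fin_two]

theorem rotMat_mul_swapMat_mul_rotMat {w : ℂ} (hw : w ≠ 0) :
    (!![w, 0; 0, w⁻¹] * !![0, 1; 1, 0] * !![w, 0; 0, w⁻¹] : Matrix (Fin 2) (Fin 2) ℂ) =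
      !![0, 1; 1, 0] := by
  simp [hw]

/-! ### Monomial matrices -/

/-- The matrix that maps the `j`-th basis vector to `c j` times the `p j`-th one. -/
def monomialMat {m : ℕ} (p : Fin m → Fin m) (c : Fin m → ℂ) : Matrix (Fin m) (Fin m) ℂ :=
  Matrix.of fun i j => if i = p j then c j else 0

theorem monomialMat_apply {m : ℕ} (p : Fin m → Fin m) (c : Fin m → ℂ) (i j : Fin m) :
    monomialMat p c i j = if i = p j then c j else 0 := rfl

theorem monomialMat_mul {m : ℕ} (p q : Fin m → Fin m) (c e : Fin m → ℂ) :
    monomialMat p c * monomialMat q e = monomialMat (p ∘ q) fun j => c (q j) * e j := by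
  ext i j
  rw [Matrix.mul_apply, Finset.sum_eq_single (q j)]
  · simp [monomialMat_apply]
  · intro k _ hk
    simp [monomialMat_apply, hk]
  · simp

theorem monomialMat_id_const {m : ℕ} (c : ℂ) :
    monomialMat (id : Fin m → Fin m) (fun _ => c) = c • 1 := by
  ext i j
  simp [monomialMat_apply, Matrix.one_apply]

theorem monomialMat_id_one {m : ℕ} : monomialMat (id : Fin m → Fin m) (fun _ => 1) = 1 := by
  rw [monomialMat_id_const, one_smul]

namespace DihedralDouble

theorem negOnePow_mul_self (k : ℕ) : ((-1) ^ k * (-1) ^ k : ℂ) = 1 := by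
  rw [← mul_pow]
  simp

theorem negOnePow_smul_mul_self (k : ℕ) {m : ℕ} {B : Matrix (Fin m) (Fin m) ℂ}
    (hB : B * B = 1) : ((-1 : ℂ) ^ k • B) * ((-1 : ℂ) ^ k • B) = 1 := by
  rw [smul_mul_smul_comm, negOnePow_mul_self, hB, one_smul]

/-! ### The matrices of the reflection classes as monomial matrices -/

section

variable {n : ℕ} [NeZero (n / 2)]

/-- The sign `(-1)^a` attached to the index `0`. -/
noncomputable def wrapSign (n : ℕ) [NeZero (n / 2)] (a : Fin 2) (i : Fin (n / 2)) : ℂ :=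
  if i = 0 then (-1) ^ (a : ℕ) else 1

theorem wrapSign_mul_self (a : Fin 2) (i : Fin (n / 2)) :
    wrapSign n a i * wrapSign n a i = 1 := by
  unfold wrapSign
  split_ifs
  · exact negOnePow_mul_self _
  · exact one_mul 1

theorem wrapSign_ne_zero (a : Fin 2) (i : Fin (n / 2)) : wrapSign n a i ≠ 0 :=
  left_ne_zero_of_mul_eq_one (wrapSign_mul_self a i)

theorem wrapSign_neg (a : Fin 2) (i : Fin (n / 2)) : wrapSign n a (-i) = wrapSign n a i := by
  simp [wrapSign, neg_eq_zero]

theorem prod_wrapSign (a : Fin 2) : ∏ i, wrapSign n a i = (-1) ^ (a : ℕ) := by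
  simp [wrapSign]

theorem val_nsmul_one (k : ℕ) : ((k • (1 : Fin (n / 2)) : Fin (n / 2)) : ℕ) = k % (n / 2) := by
  induction k with
  | zero => simp
  | succ k ih => rw [succ_nsmul, Fin.val_add, ih, Fin.val_one', ← Nat.add_mod]

theorem val_nsmul_one_self (i : Fin (n / 2)) : (i : ℕ) • (1 : Fin (n / 2)) = i :=
  Fin.ext (by rw [val_nsmul_one, Nat.mod_eq_of_lt i.isLt])

theorem half_nsmul_one : (n / 2) • (1 : Fin (n / 2)) = 0 :=
  Fin.ext (by rw [val_nsmul_one, Nat.mod_self, Fin.val_zero])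

namespace IrrepLabel

theorem matA_eq (a : Fin 2) :
    matA n a = monomialMat (fun j => j + 1) fun j => wrapSign n a (j + 1) := by
  ext i j
  have h1 : (i : ℕ) + 1 ≡ (j : ℕ) + 1 + 1 [MOD n / 2] ↔ i = j + 1 := by
    rw [Fin.ext_iff, Fin.val_add, Fin.val_one', Nat.add_mod_mod]
    constructor
    · intro h
      have := Nat.ModEq.add_right_cancel' 1 h
      rwa [Nat.ModEq, Nat.mod_eq_of_lt i.isLt] at this
    · intro h
      refine Nat.ModEq.add_right 1 ?_
      rw [Nat.ModEq, Nat.mod_eq_of_lt i.isLt, h]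
  have h2 : (i : ℕ) + 1 = 1 ↔ i = 0 := by
    rw [Fin.ext_iff, Fin.val_zero]
    omega
  simp only [matA, Matrix.of_apply, monomialMat_apply, h1, h2, wrapSign]
  by_cases h : i = j + 1
  · simp [h]
  · simp [h]

/-- Numbering from `0` turns `i + j = 2` into `i = -j`. The sign, attached to the row, may be read
off the column because negation fixes the index `0`. -/
theorem matBEven_eq (a : Fin 2) : matBEven n a = monomialMat (fun j => -j) (wrapSign n a) := by
  ext i j
  have h1 : (i : ℕ) + 1 + ((j : ℕ) + 1) ≡ 2 [MOD n / 2] ↔ i = -j := by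
    rw [eq_neg_iff_add_eq_zero, Fin.ext_iff, Fin.val_add, Fin.val_zero,
      show (i : ℕ) + 1 + ((j : ℕ) + 1) = (i + j : ℕ) + 2 by ring]
    constructor
    · intro h
      have := Nat.ModEq.add_right_cancel' (a := i + j) (b := 0) 2 (by simpa using h)
      simpa [Nat.ModEq] using this
    · intro h
      have : (i + j : ℕ) ≡ 0 [MOD n / 2] := by simpa [Nat.ModEq] using h
      simpa using this.add_right 2
  have h2 : (i : ℕ) + 1 = 1 ↔ i = 0 := by
    rw [Fin.ext_iff, Fin.val_zero]
    omega
  simp only [matBEven, Matrix.of_apply, monomialMat_apply, h1, h2]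
  by_cases h : i = -j
  · subst h
    rw [← wrapSign_neg]
    simp [wrapSign]
  · simp [h]

theorem matBOdd_eq : matBOdd n = monomialMat (fun j => -(j + 1)) fun _ => 1 := by
  ext i j
  have h1 : (i : ℕ) + 1 + ((j : ℕ) + 1) ≡ n / 2 + 1 [MOD n / 2] ↔ i = -(j + 1) := by
    rw [eq_neg_iff_add_eq_zero, ← add_assoc i j 1, Fin.ext_iff, Fin.val_add, Fin.val_add, Fin.val_zero,
      Fin.val_one', Nat.mod_add_mod, Nat.add_mod_mod,
      show (i : ℕ) + 1 + ((j : ℕ) + 1) = (i + j + 1 : ℕ) + 1 by ring]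
    constructor
    · intro h
      have := Nat.ModEq.add_right_cancel' 1 h
      simpa [Nat.ModEq] using this
    · intro h
      refine Nat.ModEq.add_right 1 ?_
      rw [Nat.ModEq, h, Nat.mod_self]
  simp only [matBOdd, Matrix.of_apply, monomialMat_apply, h1]

theorem matA_pow (a : Fin 2) (k : ℕ) :
    matA n a ^ k = monomialMat (fun j => j + k • 1)
      fun j => ∏ i ∈ Finset.range k, wrapSign n a (j + 1 + i • 1) := by
  induction k with
  | zero =>
    rw [pow_zero, ← monomialMat_id_one]
    congr 1
    funext j
    simp
  | succ k ih =>
    rw [pow_succ', ih, matA_eq, monomialMat_mul]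
    congr 1
    · funext j
      simp [succ_nsmul, add_assoc]
    · funext j
      rw [Finset.prod_range_succ, mul_comm, add_right_comm]

/-- After `n/2` steps the cyclic shift returns to its start, having passed the index `0`, which
carries the sign `(-1)^a`, exactly once. -/
theorem matA_pow_half (a : Fin 2) : matA n a ^ (n / 2) = ((-1) ^ (a : ℕ) : ℂ) • 1 := by
  rw [matA_pow, ← monomialMat_id_const, half_nsmul_one]
  congr 1
  · funext j
    simp
  · funext j
    rw [Finset.prod_range]
    simp only [val_nsmul_one_self]
    rw [← prod_wrapSign (n := n) a]
    exact Equiv.prod_comp (Equiv.addLeft (j + 1)) (wrapSign n a)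

theorem matA_pow_eq_one (hn : Even n) (a : Fin 2) : matA n a ^ n = 1 := by
  have h : matA n a ^ n = matA n a ^ (n / 2 * 2) :=
    congrArg (matA n a ^ ·) ((mul_comm _ _).trans (two_mul_half hn)).symm
  rw [h, pow_mul, matA_pow_half, sq, smul_mul_smul_comm, negOnePow_mul_self, one_mul, one_smul]

theorem matBEven_mul_self (a : Fin 2) : matBEven n a * matBEven n a = 1 := by
  rw [matBEven_eq, monomialMat_mul, ← monomialMat_id_one]
  congr 1
  · funext j
    simp
  · funext j
    rw [wrapSign_neg, wrapSign_mul_self]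

theorem matBOdd_mul_self : matBOdd n * matBOdd n = 1 := by
  rw [matBOdd_eq, monomialMat_mul, ← monomialMat_id_one]
  congr 1
  · funext j
    simp
  · simp

theorem matA_mul_matBEven_mul_matA (a : Fin 2) :
    matA n a * matBEven n a * matA n a = matBEven n a := by
  rw [matBEven_eq, matA_eq, monomialMat_mul, monomialMat_mul]
  congr 1
  · funext j
    simp
  · funext j
    rw [mul_assoc, wrapSign_mul_self, mul_one, neg_add_rev, neg_add_cancel_comm, wrapSign_neg]

theorem matA_mul_matBOdd_mul_matA (a : Fin 2) :
    matA n a * matBOdd n * matA n a = matBOdd n := by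
  rw [matBOdd_eq, matA_eq, monomialMat_mul, monomialMat_mul]
  congr 1
  · funext j
    simp
  · funext j
    rw [mul_one, neg_add_rev, neg_add_cancel_comm, wrapSign_neg, wrapSign_mul_self]

end IrrepLabel

end

end DihedralDouble

/-! ## The listed representations of `D(D_n)` -/

namespace DihedralDouble

open DihedralGroup

theorem half_neZero {n : ℕ} [NeZero n] (hn : Even n) : NeZero (n / 2) :=
  ⟨fun h => NeZero.ne n (by rw [← two_mul_half hn, h, mul_zero])⟩

theorem isPrimitiveRoot_ω (n : ℕ) [NeZero n] : IsPrimitiveRoot (ω n) n :=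
  Complex.isPrimitiveRoot_exp n (NeZero.ne n)

theorem ω_ne_zero (n : ℕ) : ω n ≠ 0 := Complex.exp_ne_zero _

theorem ω_pow_pow (n : ℕ) [NeZero n] (k : ℕ) : (ω n ^ k) ^ n = 1 := by
  rw [← pow_mul, mul_comm, pow_mul, (isPrimitiveRoot_ω n).pow_eq_one, one_pow]

/-- The matrix indices live modulo `n/2` and the exponents of `σ` modulo `n`. The degree `σ^(2j) τ`
depends only on `j` modulo `n/2`. -/
theorem two_mul_natCast_eq_of_modEq {n x y : ℕ} (hn : Even n) (h : x ≡ y [MOD n / 2]) :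
    (2 * x : ZMod n) = 2 * y := by
  have h' := Nat.ModEq.mul_left' 2 h
  rw [two_mul_half hn, ← ZMod.natCast_eq_natCast_iff] at h'
  simpa using h'

theorem σ_pow_ne_inv {n : ℕ} (hn : Even n) (k : HalfRange n) :
    σ n ^ (k.val : ℕ) ≠ (σ n ^ (k.val : ℕ))⁻¹ := by
  rw [σ_pow, inv_r]
  intro h
  exact add_self_ne_zero_of_halfRange hn k (eq_neg_iff_add_eq_zero.mp (r.inj h))

namespace IrrepLabel

section

variable {n : ℕ}

theorem dim_pos [NeZero n] (hn : Even n) (ℓ : IrrepLabel n) : 0 < ℓ.dim := by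
  have := (half_neZero hn).pos
  cases ℓ <;> simp [dim] <;> omega

/-- The degrees of the basis vectors with respect to the grading by the group. -/
def deg : (ℓ : IrrepLabel n) → Fin ℓ.dim → DihedralGroup n
  | oneDim1 _ _ => (fun _ => 1 : Fin 1 → DihedralGroup n)
  | oneDim2 _ => (fun _ => 1 : Fin 2 → DihedralGroup n)
  | centralDim1 _ _ => (fun _ => σ n ^ (n / 2) : Fin 1 → DihedralGroup n)
  | centralDim2 _ => (fun _ => σ n ^ (n / 2) : Fin 2 → DihedralGroup n)
  | rot _ k => (![σ n ^ (k.val : ℕ), (σ n ^ (k.val : ℕ))⁻¹] : Fin 2 → DihedralGroup n)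
  | reflEven _ _ => (fun i => σ n ^ (2 * (i : ℕ)) * τ n : Fin (n / 2) → DihedralGroup n)
  | reflOdd _ _ => (fun i => σ n ^ (2 * (i : ℕ) + 1) * τ n : Fin (n / 2) → DihedralGroup n)

theorem isConj_rep_deg [NeZero n] (hn : Even n) (ℓ : IrrepLabel n) (j : Fin ℓ.dim) :
    IsConj ℓ.cls.rep (ℓ.deg j) := by
  have h : ∀ c : ClassLabel n, ∀ i, IsConj c.rep (c.elem i) := fun c i =>
    (Set.ext_iff.mp (c.range_elem hn) _).mp ⟨i, rfl⟩
  cases ℓ with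
  | oneDim1 a b => exact h .one (0 : Fin 1)
  | oneDim2 k => exact h .one (0 : Fin 1)
  | centralDim1 a b => exact h .central (0 : Fin 1)
  | centralDim2 k => exact h .central (0 : Fin 1)
  | rot i k => exact h (.rot k) j
  | reflEven a b => exact h .reflEven j
  | reflOdd a b => exact h .reflOdd j

theorem sum_ite_single_eq_diagonal {m : ℕ} (s : Fin m → DihedralGroup n) (g : DihedralGroup n) :
    (∑ j, if g = s j then Matrix.single j j 1 else 0 : Matrix (Fin m) (Fin m) ℂ) =
      Matrix.diagonal fun j => if g = s j then 1 else 0 := by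
  ext i l
  rw [Matrix.sum_apply, Finset.sum_eq_single i]
  · split_ifs with h <;> simp [Matrix.single_apply, Matrix.diagonal_apply, h]
  · intro j _ hj
    split_ifs <;> simp [hj]
  · simp

theorem ite_one_eq_diagonal {m : ℕ} (p : Prop) [Decidable p] :
    (if p then 1 else 0 : Matrix (Fin m) (Fin m) ℂ) =
      Matrix.diagonal fun _ => if p then 1 else 0 := by
  split_ifs <;> simp

theorem ite_ite_eq_diagonal {α : Type*} [DecidableEq α] {x y : α} (hxy : x ≠ y) (g : α) :
    (if g = x then !![1, 0; 0, 0] else if g = y then !![0, 0; 0, 1] else 0 :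
      Matrix (Fin 2) (Fin 2) ℂ) =
      Matrix.diagonal fun j : Fin 2 => if g = ![x, y] j then 1 else 0 := by
  ext i l
  by_cases h1 : g = x
  · subst h1
    fin_cases i <;> fin_cases l <;> simp [hxy]
  · by_cases h2 : g = y
    · subst h2
      fin_cases i <;> fin_cases l <;> simp [h1]
    · fin_cases i <;> fin_cases l <;> simp [h1, h2]

/-- All listed forms of `g^*` are the projection to the basis vectors of degree `g`, which is how
`gradedRep` acts. -/
theorem dualMat_eq (hn : Even n) (ℓ : IrrepLabel n) (g : DihedralGroup n) :
    ℓ.dualMat g = Matrix.diagonal fun j => if g = ℓ.deg j then 1 else 0 := by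
  cases ℓ with
  | oneDim1 a b => exact ite_one_eq_diagonal _
  | oneDim2 k => exact ite_one_eq_diagonal _
  | centralDim1 a b => exact ite_one_eq_diagonal _
  | centralDim2 k => exact ite_one_eq_diagonal _
  | rot j k => exact ite_ite_eq_diagonal (σ_pow_ne_inv hn k) g
  | reflEven a b => exact sum_ite_single_eq_diagonal _ g
  | reflOdd a b => exact sum_ite_single_eq_diagonal _ g

theorem sigmaMat_compatible (hn : Even n) (ℓ : IrrepLabel n) (i j : Fin ℓ.dim)
    (h : ℓ.sigmaMat i j ≠ 0) : ℓ.deg i = r 1 * ℓ.deg j * (r 1)⁻¹ := by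
  cases ℓ with
  | oneDim1 a b => exact (mul_inv_cancel (r (1 : ZMod n))).symm.trans (by rw [deg, mul_one])
  | oneDim2 k => exact (mul_inv_cancel (r (1 : ZMod n))).symm.trans (by rw [deg, mul_one])
  | centralDim1 a b =>
    change σ n ^ (n / 2) = r 1 * σ n ^ (n / 2) * (r 1)⁻¹
    simp [σ_pow]
  | centralDim2 k =>
    change σ n ^ (n / 2) = r 1 * σ n ^ (n / 2) * (r 1)⁻¹
    simp [σ_pow]
  | rot l k =>
    have h' : (!![ω n ^ (l : ℕ), 0; 0, (ω n ^ (l : ℕ))⁻¹] : Matrix (Fin 2) (Fin 2) ℂ) i j ≠ 0 := h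
    change (![σ n ^ (k.val : ℕ), (σ n ^ (k.val : ℕ))⁻¹] : Fin 2 → _) i =
      r 1 * (![σ n ^ (k.val : ℕ), (σ n ^ (k.val : ℕ))⁻¹] : Fin 2 → _) j * (r 1)⁻¹
    change Fin 2 at i j
    fin_cases i <;> fin_cases j <;> simp [σ_pow] at h' ⊢
  | reflEven a b =>
    change Fin (n / 2) at i j
    have h' : matA n a i j ≠ 0 := h
    have hij : (i : ℕ) + 1 ≡ (j : ℕ) + 1 + 1 [MOD n / 2] := by
      by_contra hne
      exact h' (by simp [matA, hne])
    have key := two_mul_natCast_eq_of_modEq hn hij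
    change σ n ^ (2 * (i : ℕ)) * τ n = r 1 * (σ n ^ (2 * (j : ℕ)) * τ n) * (r 1)⁻¹
    rw [σ_pow_mul_τ, σ_pow_mul_τ, r_mul_sr, inv_r, sr_mul_r, sr.injEq]
    push_cast at key ⊢
    linear_combination -key
  | reflOdd a b =>
    change Fin (n / 2) at i j
    have h' : matA n a i j ≠ 0 := h
    have hij : (i : ℕ) + 1 ≡ (j : ℕ) + 1 + 1 [MOD n / 2] := by
      by_contra hne
      exact h' (by simp [matA, hne])
    have key := two_mul_natCast_eq_of_modEq hn hij
    change σ n ^ (2 * (i : ℕ) + 1) * τ n = r 1 * (σ n ^ (2 * (j : ℕ) + 1) * τ n) * (r 1)⁻¹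
    rw [σ_pow_mul_τ, σ_pow_mul_τ, r_mul_sr, inv_r, sr_mul_r, sr.injEq]
    push_cast at key ⊢
    linear_combination -key

theorem tauMat_compatible (hn : Even n) (ℓ : IrrepLabel n) (i j : Fin ℓ.dim)
    (h : ℓ.tauMat i j ≠ 0) : ℓ.deg i = sr 0 * ℓ.deg j * (sr 0)⁻¹ := by
  cases ℓ with
  | oneDim1 a b => exact (mul_inv_cancel (sr (0 : ZMod n))).symm.trans (by rw [deg, mul_one])
  | oneDim2 k => exact (mul_inv_cancel (sr (0 : ZMod n))).symm.trans (by rw [deg, mul_one])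
  | centralDim1 a b =>
    change σ n ^ (n / 2) = sr 0 * σ n ^ (n / 2) * (sr 0)⁻¹
    simp [σ_pow, neg_half hn]
  | centralDim2 k =>
    change σ n ^ (n / 2) = sr 0 * σ n ^ (n / 2) * (sr 0)⁻¹
    simp [σ_pow, neg_half hn]
  | rot l k =>
    have h' : (!![0, 1; 1, 0] : Matrix (Fin 2) (Fin 2) ℂ) i j ≠ 0 := h
    change (![σ n ^ (k.val : ℕ), (σ n ^ (k.val : ℕ))⁻¹] : Fin 2 → _) i =
      sr 0 * (![σ n ^ (k.val : ℕ), (σ n ^ (k.val : ℕ))⁻¹] : Fin 2 → _) j * (sr 0)⁻¹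
    change Fin 2 at i j
    fin_cases i <;> fin_cases j <;> simp [σ_pow] at h' ⊢
  | reflEven a b =>
    change Fin (n / 2) at i j
    have h' : ((-1 : ℂ) ^ ((a : ℕ) + (b : ℕ)) • matBEven n a) i j ≠ 0 := h
    have hij : (i : ℕ) + 1 + ((j : ℕ) + 1) ≡ 2 [MOD n / 2] := by
      by_contra hne
      exact h' (by simp [matBEven, hne])
    have key := two_mul_natCast_eq_of_modEq hn hij
    change σ n ^ (2 * (i : ℕ)) * τ n = sr 0 * (σ n ^ (2 * (j : ℕ)) * τ n) * (sr 0)⁻¹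
    rw [σ_pow_mul_τ, σ_pow_mul_τ, sr_mul_sr, inv_sr, r_mul_sr, sr.injEq]
    push_cast at key ⊢
    linear_combination -key
  | reflOdd a b =>
    change Fin (n / 2) at i j
    have h' : ((-1 : ℂ) ^ ((a : ℕ) + (b : ℕ)) • matBOdd n) i j ≠ 0 := h
    have hij : (i : ℕ) + 1 + ((j : ℕ) + 1) ≡ n / 2 + 1 [MOD n / 2] := by
      by_contra hne
      exact h' (by rw [Matrix.smul_apply, matBOdd, Matrix.of_apply, if_neg hne, smul_zero])
    -- The summand `n/2` vanishes modulo `n/2`, so the index equation reads `i + j = 1` in numbering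
    -- from `1`.
    have key := two_mul_natCast_eq_of_modEq hn (hij.trans (c := 1) (by simp [Nat.ModEq]))
    change σ n ^ (2 * (i : ℕ) + 1) * τ n = sr 0 * (σ n ^ (2 * (j : ℕ) + 1) * τ n) * (sr 0)⁻¹
    rw [σ_pow_mul_τ, σ_pow_mul_τ, sr_mul_sr, inv_sr, r_mul_sr, sr.injEq]
    push_cast at key ⊢
    linear_combination -key

/-! ### The dihedral relations and the resulting representations -/

variable [NeZero n]

theorem sigmaMat_pow (hn : Even n) (ℓ : IrrepLabel n) : ℓ.sigmaMat ^ n = 1 := by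
  have := half_neZero hn
  cases ℓ with
  | oneDim1 a b => exact signMat_pow hn a
  | oneDim2 k => exact rotMat_pow_eq_one (ω_pow_pow n _)
  | centralDim1 a b => exact signMat_pow hn a
  | centralDim2 k => exact rotMat_pow_eq_one (ω_pow_pow n _)
  | rot j k => exact rotMat_pow_eq_one (ω_pow_pow n _)
  | reflEven a b => exact matA_pow_eq_one hn a
  | reflOdd a b => exact matA_pow_eq_one hn a

theorem tauMat_mul_self (hn : Even n) (ℓ : IrrepLabel n) : ℓ.tauMat * ℓ.tauMat = 1 := by
  have := half_neZero hn
  cases ℓ with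
  | oneDim1 a b => exact signMat_mul_self b
  | oneDim2 k => exact swapMat_mul_self
  | centralDim1 a b => exact signMat_mul_self b
  | centralDim2 k => exact swapMat_mul_self
  | rot j k => exact swapMat_mul_self
  | reflEven a b => exact negOnePow_smul_mul_self _ (matBEven_mul_self a)
  | reflOdd a b => exact negOnePow_smul_mul_self _ matBOdd_mul_self

theorem sigmaMat_mul_tauMat_mul_sigmaMat (hn : Even n) (ℓ : IrrepLabel n) :
    ℓ.sigmaMat * ℓ.tauMat * ℓ.sigmaMat = ℓ.tauMat := by
  have := half_neZero hn
  have hω := fun k : ℕ => pow_ne_zero k (ω_ne_zero n)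
  cases ℓ with
  | oneDim1 a b => exact signMat_mul_signMat_mul_signMat a b
  | oneDim2 k => exact rotMat_mul_swapMat_mul_rotMat (hω _)
  | centralDim1 a b => exact signMat_mul_signMat_mul_signMat a b
  | centralDim2 k => exact rotMat_mul_swapMat_mul_rotMat (hω _)
  | rot j k => exact rotMat_mul_swapMat_mul_rotMat (hω _)
  | reflEven a b =>
    change matA n a * ((-1 : ℂ) ^ ((a : ℕ) + (b : ℕ)) • matBEven n a) * matA n a =
      (-1 : ℂ) ^ ((a : ℕ) + (b : ℕ)) • matBEven n a
    rw [Matrix.mul_smul, Matrix.smul_mul, matA_mul_matBEven_mul_matA]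
  | reflOdd a b =>
    change matA n a * ((-1 : ℂ) ^ ((a : ℕ) + (b : ℕ)) • matBOdd n) * matA n a =
      (-1 : ℂ) ^ ((a : ℕ) + (b : ℕ)) • matBOdd n
    rw [Matrix.mul_smul, Matrix.smul_mul, matA_mul_matBOdd_mul_matA]

/-- The representation with the given label. -/
noncomputable def toRep (hn : Even n) (ℓ : IrrepLabel n) :
    QuantumDouble (DihedralGroup n) →ₐ[ℂ] Matrix (Fin ℓ.dim) (Fin ℓ.dim) ℂ :=
  QuantumDouble.gradedRep
    (homOfRelations ℓ.sigmaMat ℓ.tauMat (ℓ.sigmaMat_pow hn) (ℓ.tauMat_mul_self hn)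
      (ℓ.sigmaMat_mul_tauMat_mul_sigmaMat hn))
    ℓ.deg
    (homOfRelations_compatible _ _ _ (ℓ.sigmaMat_compatible hn) (ℓ.tauMat_compatible hn))

theorem toRep_of_σ (hn : Even n) (ℓ : IrrepLabel n) :
    ℓ.toRep hn (QuantumDouble.of (σ n)) = ℓ.sigmaMat := by
  rw [toRep, QuantumDouble.gradedRep_of]
  -- The residue `1` has value `1` unless `n = 1`, which evenness excludes.
  have h1 : (1 : ZMod n).val = 1 := by
    refine ZMod.val_one'' ?_
    rintro rfl
    exact absurd hn (by decide)
  change ℓ.sigmaMat ^ (1 : ZMod n).val = _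
  rw [h1, pow_one]

theorem toRep_of_τ (hn : Even n) (ℓ : IrrepLabel n) :
    ℓ.toRep hn (QuantumDouble.of (τ n)) = ℓ.tauMat := by
  rw [toRep, QuantumDouble.gradedRep_of]
  change ℓ.tauMat * ℓ.sigmaMat ^ (0 : ZMod n).val = _
  rw [ZMod.val_zero, pow_zero, mul_one]

theorem toRep_of_σ_pow (hn : Even n) (ℓ : IrrepLabel n) (k : ℕ) :
    ℓ.toRep hn (QuantumDouble.of (σ n) ^ k) = ℓ.sigmaMat ^ k := by
  rw [map_pow, toRep_of_σ]

theorem toRep_dual (hn : Even n) (ℓ : IrrepLabel n) (g : DihedralGroup n) :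
    ℓ.toRep hn (QuantumDouble.dual g) = Matrix.diagonal fun j => if g = ℓ.deg j then 1 else 0 :=
  QuantumDouble.gradedRep_dual _ _ _ g

theorem toRep_dual_deg (hn : Even n) (ℓ : IrrepLabel n) (h : Function.Injective ℓ.deg)
    (j : Fin ℓ.dim) : ℓ.toRep hn (QuantumDouble.dual (ℓ.deg j)) = Matrix.single j j 1 := by
  rw [toRep_dual]
  ext i l
  simp only [Matrix.diagonal_apply, Matrix.single_apply, h.eq_iff]
  grind

end

end IrrepLabel

end DihedralDouble

/-! ### Signs and roots of unity as invariants -/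

namespace DihedralDouble

open DihedralGroup

theorem negOnePow_injective {a b : Fin 2} (h : (-1 : ℂ) ^ (a : ℕ) = (-1) ^ (b : ℕ)) : a = b := by
  fin_cases a <;> fin_cases b <;> first | rfl | norm_num at h

theorem halfRange_eq_of_ω {n : ℕ} [NeZero n] (hn : Even n) {k l : HalfRange n}
    (h : ω n ^ (k.val : ℕ) + (ω n ^ (k.val : ℕ))⁻¹ = ω n ^ (l.val : ℕ) + (ω n ^ (l.val : ℕ))⁻¹) :
    k = l := by
  have h2 := two_mul_half hn
  have hk := k.val.2
  have hl := l.val.2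
  have hk' := k.2
  have hx : ω n ^ (k.val : ℕ) ≠ 0 := pow_ne_zero _ (ω_ne_zero n)
  have hy : ω n ^ (l.val : ℕ) ≠ 0 := pow_ne_zero _ (ω_ne_zero n)
  -- With `x = ω^k` and `y = ω^l`, the equation `x + x⁻¹ = y + y⁻¹` factors as `(x - y)(xy - 1) =
  -- 0`. The second factor is nonzero because `0 < k + l < n`.
  have key : (ω n ^ (k.val : ℕ) - ω n ^ (l.val : ℕ)) *
      (ω n ^ (k.val : ℕ) * ω n ^ (l.val : ℕ) - 1) = 0 := by
    field_simp at h
    linear_combination h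
  rcases mul_eq_zero.mp key with h3 | h3
  · have := (isPrimitiveRoot_ω n).pow_inj (by omega) (by omega) (sub_eq_zero.mp h3)
    exact Subtype.ext (Fin.ext this)
  · rw [← pow_add, sub_eq_zero, (isPrimitiveRoot_ω n).pow_eq_one_iff_dvd] at h3
    have := Nat.le_of_dvd (by omega) h3
    omega

theorem ω_pow_sub_inv_ne_zero {n : ℕ} [NeZero n] (hn : Even n) (k : HalfRange n) :
    ω n ^ (k.val : ℕ) - (ω n ^ (k.val : ℕ))⁻¹ ≠ 0 := by
  have h2 := two_mul_half hn
  have hk := k.val.2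
  have hk' := k.2
  have hx : ω n ^ (k.val : ℕ) ≠ 0 := pow_ne_zero _ (ω_ne_zero n)
  intro h
  rw [sub_eq_zero, ← mul_eq_one_iff_eq_inv₀ hx, ← pow_add, (isPrimitiveRoot_ω n).pow_eq_one_iff_dvd] at h
  have := Nat.le_of_dvd (by omega) h
  omega

/-! ### Irreducibility -/

section

variable {A : Type*} [Ring A] [Algebra ℂ A]

theorem surjective_of_dim_one (ρ : A →ₐ[ℂ] Matrix (Fin 1) (Fin 1) ℂ) : Function.Surjective ρ := by
  refine RepModule.surjective_of_single_mem_range 0 (fun i => ⟨1, ?_⟩) fun i => ⟨1, 1, ?_⟩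
  · rw [map_one]
    ext j l
    fin_cases i
    fin_cases j
    fin_cases l
    simp
  · fin_cases i
    simp

theorem swapMat_links (ρ : A →ₐ[ℂ] Matrix (Fin 2) (Fin 2) ℂ) {T : A}
    (hT : ρ T = !![0, 1; 1, 0]) (i : Fin 2) : ∃ a b, ρ a i 0 ≠ 0 ∧ ρ b 0 i ≠ 0 := by
  fin_cases i
  · exact ⟨1, 1, by simp⟩
  · exact ⟨T, T, by simp [hT]⟩

/-- The eigenvalues `w` and `w⁻¹` are distinct, so the diagonal units are Lagrange polynomials in
the matrix of `S`; the swap links the two indices. -/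
theorem surjective_of_rotMat_swapMat (ρ : A →ₐ[ℂ] Matrix (Fin 2) (Fin 2) ℂ) {S T : A} {w : ℂ}
    (hw : w - w⁻¹ ≠ 0) (hS : ρ S = !![w, 0; 0, w⁻¹]) (hT : ρ T = !![0, 1; 1, 0]) :
    Function.Surjective ρ := by
  have hw' : w⁻¹ - w ≠ 0 := by
    rw [← neg_sub]
    exact neg_ne_zero.mpr hw
  refine RepModule.surjective_of_single_mem_range 0 (fun i => ?_) (swapMat_links ρ hT)
  fin_cases i
  · refine ⟨(w - w⁻¹)⁻¹ • (S - w⁻¹ • 1), ?_⟩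
    rw [map_smul, map_sub, map_smul, hS, map_one]
    ext j l
    fin_cases j <;> fin_cases l <;> simp [hw]
  · refine ⟨(w⁻¹ - w)⁻¹ • (S - w • 1), ?_⟩
    rw [map_smul, map_sub, map_smul, hS, map_one]
    ext j l
    fin_cases j <;> fin_cases l <;> simp [hw']

/-- The shift `A` permutes the indices in a single cycle: `A^i` leads from index `0` to `i`, and
`A^(n/2 - i)` leads back. -/
theorem surjective_of_matA {n : ℕ} [NeZero (n / 2)]
    (ρ : A →ₐ[ℂ] Matrix (Fin (n / 2)) (Fin (n / 2)) ℂ) {S : A} {a : Fin 2}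
    (hS : ρ S = IrrepLabel.matA n a) (hdiag : ∀ i, ∃ x, ρ x = Matrix.single i i 1) :
    Function.Surjective ρ := by
  refine RepModule.surjective_of_single_mem_range 0 hdiag fun i =>
    ⟨S ^ (i : ℕ), S ^ (n / 2 - (i : ℕ)), ?_, ?_⟩
  · rw [map_pow, hS, IrrepLabel.matA_pow, monomialMat_apply, zero_add, val_nsmul_one_self,
      if_pos rfl]
    exact Finset.prod_ne_zero_iff.mpr fun _ _ => wrapSign_ne_zero _ _
  · have h : i + (n / 2 - (i : ℕ)) • (1 : Fin (n / 2)) = 0 := by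
      nth_rewrite 1 [← val_nsmul_one_self i]
      rw [← add_nsmul, Nat.add_sub_cancel' i.isLt.le, half_nsmul_one]
    rw [map_pow, hS, IrrepLabel.matA_pow, monomialMat_apply, h, if_pos rfl]
    exact Finset.prod_ne_zero_iff.mpr fun _ _ => wrapSign_ne_zero _ _

end

namespace IrrepLabel

section

variable {n : ℕ}

/-! ### Counting -/

theorem card_halfRange : Fintype.card (HalfRange n) = n / 2 - 1 := by
  rw [← Fintype.card_fin (n / 2 - 1)]
  refine Fintype.card_congr
    { toFun := fun k => ⟨k.val - 1, by have := k.val.2; have := k.2; omega⟩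
      invFun := fun i => ⟨⟨i + 1, by have := i.2; omega⟩, Nat.le_add_left 1 i⟩
      left_inv := fun k => Subtype.ext (Fin.ext (Nat.sub_add_cancel k.2))
      right_inv := fun i => Fin.ext (Nat.add_sub_cancel _ _) }

theorem sum_eq (f : IrrepLabel n → ℕ) :
    ∑ ℓ, f ℓ = ∑ x : Fin 2 × Fin 2, f (oneDim1 x.1 x.2) + ∑ k, f (oneDim2 k) +
      ∑ x : Fin 2 × Fin 2, f (centralDim1 x.1 x.2) + ∑ k, f (centralDim2 k) +
      ∑ x : Fin n × HalfRange n, f (rot x.1 x.2) +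
      ∑ x : Fin 2 × Fin 2, f (reflEven x.1 x.2) + ∑ x : Fin 2 × Fin 2, f (reflOdd x.1 x.2) := by
  let e : ((((((Fin 2 × Fin 2) ⊕ HalfRange n) ⊕ (Fin 2 × Fin 2)) ⊕ HalfRange n) ⊕
      (Fin n × HalfRange n)) ⊕ (Fin 2 × Fin 2)) ⊕ (Fin 2 × Fin 2) ≃ IrrepLabel n :=
    { toFun := Sum.elim (Sum.elim (Sum.elim (Sum.elim (Sum.elim (Sum.elim
          (fun x => oneDim1 x.1 x.2) oneDim2) (fun x => centralDim1 x.1 x.2)) centralDim2)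
          (fun x => rot x.1 x.2)) (fun x => reflEven x.1 x.2)) (fun x => reflOdd x.1 x.2)
      invFun := fun ℓ => match ℓ with
        | oneDim1 a b => .inl (.inl (.inl (.inl (.inl (.inl (a, b))))))
        | oneDim2 k => .inl (.inl (.inl (.inl (.inl (.inr k)))))
        | centralDim1 a b => .inl (.inl (.inl (.inl (.inr (a, b)))))
        | centralDim2 k => .inl (.inl (.inl (.inr k)))
        | rot j k => .inl (.inl (.inr (j, k)))
        | reflEven a b => .inl (.inr (a, b))
        | reflOdd a b => .inr (a, b)
      left_inv := by rintro ((((((x | x) | x) | x) | x) | x) | x) <;> rfl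
      right_inv := by rintro (_ | _ | _ | _ | _ | _ | _) <;> rfl }
  rw [← e.sum_comp f]
  simp only [Fintype.sum_sum_type]
  rfl

/-- The contributions are added rather than separated into cases, so the formula remains correct
when `n/2` equals `1` or `2`. -/
theorem card_dim_eq (d : ℕ) : Nat.card {ℓ : IrrepLabel n // ℓ.dim = d} =
    (if d = 1 then 8 else 0) + (if d = n / 2 then 8 else 0) +
      (if d = 2 then (n + 2) * (n / 2 - 1) else 0) := by
  rw [Nat.card_eq_fintype_card, Fintype.card_subtype, Finset.card_filter, sum_eq]
  simp only [dim, Finset.sum_const, Finset.card_univ, Fintype.card_prod, Fintype.card_fin,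
    card_halfRange, smul_eq_mul, eq_comm (b := d)]
  split_ifs <;> ring

theorem card_cls_reflEven : Nat.card {ℓ : IrrepLabel n // ℓ.cls = .reflEven} = 4 := by
  have h : Function.Bijective fun x : Fin 2 × Fin 2 =>
      (⟨reflEven x.1 x.2, rfl⟩ : {ℓ : IrrepLabel n // ℓ.cls = .reflEven}) := by
    refine ⟨fun x y hxy => ?_, ?_⟩
    · cases x
      cases y
      cases hxy
      rfl
    · rintro ⟨_ | _ | _ | _ | _ | ⟨a, b⟩ | _, h⟩
      case reflEven => exact ⟨(a, b), rfl⟩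
      all_goals cases h
  simpa using (Nat.card_congr (Equiv.ofBijective _ h)).symm

theorem card_cls_reflOdd : Nat.card {ℓ : IrrepLabel n // ℓ.cls = .reflOdd} = 4 := by
  have h : Function.Bijective fun x : Fin 2 × Fin 2 =>
      (⟨reflOdd x.1 x.2, rfl⟩ : {ℓ : IrrepLabel n // ℓ.cls = .reflOdd}) := by
    refine ⟨fun x y hxy => ?_, ?_⟩
    · cases x
      cases y
      cases hxy
      rfl
    · rintro ⟨_ | _ | _ | _ | _ | _ | ⟨a, b⟩, h⟩
      case reflOdd => exact ⟨(a, b), rfl⟩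
      all_goals cases h
  simpa using (Nat.card_congr (Equiv.ofBijective _ h)).symm

/-! ### Traces -/

theorem signMat_trace (a : ℕ) : (!![(-1) ^ a] : Matrix (Fin 1) (Fin 1) ℂ).trace = (-1) ^ a := by
  simp [Matrix.trace]

theorem rotMat_trace (w : ℂ) : (!![w, 0; 0, w⁻¹] : Matrix (Fin 2) (Fin 2) ℂ).trace = w + w⁻¹ := by
  simp [Matrix.trace_fin_two]

theorem neg_one_pow_add_mul (a b : ℕ) : ((-1) ^ (a + b) * (-1) ^ a : ℂ) = (-1) ^ b := by
  rw [pow_add, mul_right_comm, negOnePow_mul_self, one_mul]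

theorem matA_pow_half_apply_zero [NeZero (n / 2)] (a : Fin 2) :
    (matA n a ^ (n / 2)) 0 0 = (-1) ^ (a : ℕ) := by
  rw [matA_pow_half]
  simp

theorem matBEven_apply_zero [NeZero (n / 2)] (a b : Fin 2) :
    ((-1 : ℂ) ^ ((a : ℕ) + (b : ℕ)) • matBEven n a) 0 0 = (-1) ^ (b : ℕ) := by
  rw [Matrix.smul_apply, matBEven_eq, monomialMat_apply, neg_zero, if_pos rfl, wrapSign,
    if_pos rfl, smul_eq_mul, neg_one_pow_add_mul]

theorem matA_mul_matBOdd_apply_zero [NeZero (n / 2)] (a b : Fin 2) :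
    (matA n a * ((-1 : ℂ) ^ ((a : ℕ) + (b : ℕ)) • matBOdd n)) 0 0 = (-1) ^ (b : ℕ) := by
  rw [Matrix.mul_smul, Matrix.smul_apply, matBOdd_eq, matA_eq, monomialMat_mul, monomialMat_apply]
  simp [wrapSign, neg_one_pow_add_mul]

end

section

variable {n : ℕ} [NeZero n]

theorem toRep_surjective (hn : Even n) (ℓ : IrrepLabel n) : Function.Surjective (ℓ.toRep hn) := by
  have := half_neZero hn
  cases ℓ with
  | oneDim1 a b => exact surjective_of_dim_one (toRep hn (oneDim1 a b))
  | oneDim2 k =>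
    exact surjective_of_rotMat_swapMat (toRep hn (oneDim2 k)) (ω_pow_sub_inv_ne_zero hn k)
      (toRep_of_σ hn (oneDim2 k)) (toRep_of_τ hn (oneDim2 k))
  | centralDim1 a b => exact surjective_of_dim_one (toRep hn (centralDim1 a b))
  | centralDim2 k =>
    exact surjective_of_rotMat_swapMat (toRep hn (centralDim2 k)) (ω_pow_sub_inv_ne_zero hn k)
      (toRep_of_σ hn (centralDim2 k)) (toRep_of_τ hn (centralDim2 k))
  | rot j k =>
    exact RepModule.surjective_of_single_mem_range (ρ := toRep hn (rot j k)) (0 : Fin 2)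
      (fun i => ⟨_, toRep_dual_deg hn (rot j k) (ClassLabel.elem_injective hn (.rot k)) i⟩)
      (swapMat_links (toRep hn (rot j k)) (toRep_of_τ hn (rot j k)))
  | reflEven a b =>
    exact surjective_of_matA (toRep hn (reflEven a b)) (toRep_of_σ hn (reflEven a b))
      fun i => ⟨_, toRep_dual_deg hn (reflEven a b) (ClassLabel.elem_injective hn .reflEven) i⟩
  | reflOdd a b =>
    exact surjective_of_matA (toRep hn (reflOdd a b)) (toRep_of_σ hn (reflOdd a b))
      fun i => ⟨_, toRep_dual_deg hn (reflOdd a b) (ClassLabel.elem_injective hn .reflOdd) i⟩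

theorem isSimpleModule_toRep (hn : Even n) (ℓ : IrrepLabel n) :
    IsSimpleModule (QuantumDouble (DihedralGroup n)) (RepModule (ℓ.toRep hn)) :=
  have : NeZero ℓ.dim := ⟨(ℓ.dim_pos hn).ne'⟩
  RepModule.isSimpleModule_of_surjective (ℓ.toRep_surjective hn)

/-! ### Non-isomorphism -/

/-- The trace of `h^*` counts the basis vectors of degree `h`, so isomorphic representations share a
degree, and all degrees of each lie in a single class. -/
theorem cls_eq_of_equiv (hn : Even n) {ℓ ℓ' : IrrepLabel n}
    (e : RepModule (ℓ.toRep hn) ≃ₗ[QuantumDouble (DihedralGroup n)] RepModule (ℓ'.toRep hn)) :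
    ℓ.cls = ℓ'.cls := by
  let j₀ : Fin ℓ.dim := ⟨0, ℓ.dim_pos hn⟩
  have h := RepModule.trace_eq_of_equiv e (QuantumDouble.dual (ℓ.deg j₀))
  rw [toRep_dual, toRep_dual, Matrix.trace_diagonal, Matrix.trace_diagonal, Finset.sum_boole,
    Finset.sum_boole, Nat.cast_inj] at h
  have hpos : 0 < (Finset.univ.filter fun j => ℓ.deg j₀ = ℓ.deg j).card :=
    Finset.card_pos.mpr ⟨j₀, by simp⟩
  rw [h] at hpos
  obtain ⟨j, hj⟩ := Finset.card_pos.mp hpos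
  have hj' : ℓ.deg j₀ = ℓ'.deg j := by simpa using hj
  refine ClassLabel.eq_of_isConj_rep hn _ _ ((ℓ.isConj_rep_deg hn j₀).trans ?_)
  rw [hj']
  exact (ℓ'.isConj_rep_deg hn j).symm

/-- When the degrees are distinct, a diagonal matrix entry is a trace and hence an isomorphism
invariant. -/
theorem trace_toRep_mul_dual (hn : Even n) (ℓ : IrrepLabel n) (h : Function.Injective ℓ.deg)
    (x : QuantumDouble (DihedralGroup n)) (j : Fin ℓ.dim) :
    (ℓ.toRep hn (x * QuantumDouble.dual (ℓ.deg j))).trace = ℓ.toRep hn x j j := by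
  rw [map_mul, toRep_dual_deg hn ℓ h, Matrix.trace_mul_single]
  simp

theorem sign_eq_of_equiv (hn : Even n) {ℓ ℓ' : IrrepLabel n} {a b a' b' : Fin 2}
    (e : RepModule (ℓ.toRep hn) ≃ₗ[QuantumDouble (DihedralGroup n)] RepModule (ℓ'.toRep hn))
    {x y : QuantumDouble (DihedralGroup n)}
    (hx : (ℓ.toRep hn x).trace = (-1) ^ (a : ℕ)) (hx' : (ℓ'.toRep hn x).trace = (-1) ^ (a' : ℕ))
    (hy : (ℓ.toRep hn y).trace = (-1) ^ (b : ℕ)) (hy' : (ℓ'.toRep hn y).trace = (-1) ^ (b' : ℕ)) :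
    a = a' ∧ b = b' :=
  ⟨negOnePow_injective (hx.symm.trans ((RepModule.trace_eq_of_equiv e x).trans hx')),
    negOnePow_injective (hy.symm.trans ((RepModule.trace_eq_of_equiv e y).trans hy'))⟩

theorem eq_of_equiv (hn : Even n) (ℓ ℓ' : IrrepLabel n)
    (e : RepModule (ℓ.toRep hn) ≃ₗ[QuantumDouble (DihedralGroup n)] RepModule (ℓ'.toRep hn)) :
    ℓ = ℓ' := by
  have := half_neZero hn
  have hc := cls_eq_of_equiv hn e
  have hd := RepModule.dim_eq_of_equiv e
  have hσ := RepModule.trace_eq_of_equiv e (QuantumDouble.of (σ n))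
  rw [toRep_of_σ, toRep_of_σ] at hσ
  have hτ := RepModule.trace_eq_of_equiv e (QuantumDouble.of (τ n))
  rw [toRep_of_τ, toRep_of_τ] at hτ
  cases ℓ with
  | oneDim1 a b =>
    cases ℓ' with
    | oneDim1 a' b' =>
      rw [negOnePow_injective ((signMat_trace a).symm.trans (hσ.trans (signMat_trace a'))),
        negOnePow_injective ((signMat_trace b).symm.trans (hτ.trans (signMat_trace b')))]
    | oneDim2 k => exact absurd hd (by simp [dim])
    | _ => exact absurd hc (by simp [cls])
  | centralDim1 a b =>
    cases ℓ' with
    | centralDim1 a' b' =>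
      rw [negOnePow_injective ((signMat_trace a).symm.trans (hσ.trans (signMat_trace a'))),
        negOnePow_injective ((signMat_trace b).symm.trans (hτ.trans (signMat_trace b')))]
    | centralDim2 k => exact absurd hd (by simp [dim])
    | _ => exact absurd hc (by simp [cls])
  | oneDim2 k =>
    cases ℓ' with
    | oneDim1 a' b' => exact absurd hd (by simp [dim])
    | oneDim2 l =>
      rw [halfRange_eq_of_ω hn ((rotMat_trace _).symm.trans (hσ.trans (rotMat_trace _)))]
    | _ => exact absurd hc (by simp [cls])
  | centralDim2 k =>
    cases ℓ' with
    | centralDim1 a' b' => exact absurd hd (by simp [dim])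
    | centralDim2 l =>
      rw [halfRange_eq_of_ω hn ((rotMat_trace _).symm.trans (hσ.trans (rotMat_trace _)))]
    | _ => exact absurd hc (by simp [cls])
  | rot j k =>
    cases ℓ' with
    | rot j' k' =>
      obtain rfl : k = k' := by simpa [cls] using hc
      have hinj := ClassLabel.elem_injective hn (.rot k)
      -- The trace of `σ` gives only `ω^j + ω^(-j)`. Multiplying by `(σ^k)^*` isolates `ω^j`, which
      -- determines `j`.
      have h := RepModule.trace_eq_of_equiv e
        (QuantumDouble.of (σ n) * QuantumDouble.dual ((rot j k).deg (0 : Fin 2)))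
      have h1 := trace_toRep_mul_dual hn (rot j k) hinj (QuantumDouble.of (σ n)) (0 : Fin 2)
      have h2 := trace_toRep_mul_dual hn (rot j' k) hinj (QuantumDouble.of (σ n)) (0 : Fin 2)
      rw [toRep_of_σ] at h1 h2
      have h3 : ω n ^ (j : ℕ) = ω n ^ (j' : ℕ) := h1.symm.trans (h.trans h2)
      rw [Fin.ext ((isPrimitiveRoot_ω n).pow_inj j.isLt j'.isLt h3)]
    | _ => exact absurd hc (by simp [cls])
  | reflEven a b =>
    cases ℓ' with
    | reflEven a' b' =>
      have hinj := ClassLabel.elem_injective hn (.reflEven)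
      -- On the line of degree `τ` the centraliser elements `σ^(n/2)` and `τ` act by `(-1)^a` and
      -- `(-1)^b`.
      have h1 := fun a b : Fin 2 => trace_toRep_mul_dual hn (reflEven a b) hinj
        (QuantumDouble.of (σ n) ^ (n / 2)) (0 : Fin (n / 2))
      have h2 := fun a b : Fin 2 => trace_toRep_mul_dual hn (reflEven a b) hinj
        (QuantumDouble.of (τ n)) (0 : Fin (n / 2))
      simp only [toRep_of_σ_pow, toRep_of_τ] at h1 h2
      obtain ⟨rfl, rfl⟩ := sign_eq_of_equiv hn e
        ((h1 a b).trans (matA_pow_half_apply_zero a))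
        ((h1 a' b').trans (matA_pow_half_apply_zero a'))
        ((h2 a b).trans (matBEven_apply_zero a b))
        ((h2 a' b').trans (matBEven_apply_zero a' b'))
      rfl
    | _ => exact absurd hc (by simp [cls])
  | reflOdd a b =>
    cases ℓ' with
    | reflOdd a' b' =>
      have hinj := ClassLabel.elem_injective hn (.reflOdd)
      -- The line of degree `στ` is fixed by `στ` rather than by `τ` alone, so `b` is read off from
      -- `στ`.
      have h1 := fun a b : Fin 2 => trace_toRep_mul_dual hn (reflOdd a b) hinj
        (QuantumDouble.of (σ n) ^ (n / 2)) (0 : Fin (n / 2))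
      have h2 := fun a b : Fin 2 => trace_toRep_mul_dual hn (reflOdd a b) hinj
        (QuantumDouble.of (σ n) * QuantumDouble.of (τ n)) (0 : Fin (n / 2))
      simp only [toRep_of_σ_pow, map_mul (toRep hn _) (QuantumDouble.of (σ n)), toRep_of_σ,
        toRep_of_τ] at h1 h2
      obtain ⟨rfl, rfl⟩ := sign_eq_of_equiv hn e
        ((h1 a b).trans (matA_pow_half_apply_zero a))
        ((h1 a' b').trans (matA_pow_half_apply_zero a'))
        ((h2 a b).trans (matA_mul_matBOdd_apply_zero a b))
        ((h2 a' b').trans (matA_mul_matBOdd_apply_zero a' b'))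
      rfl
    | _ => exact absurd hc (by simp [cls])

theorem sum_dim_sq (hn : Even n) :
    ∑ ℓ : IrrepLabel n, ℓ.dim ^ 2 = Nat.card (DihedralGroup n) ^ 2 := by
  -- Writing `n = 2(m + 1)` removes the truncated subtraction `n/2 - 1` and leaves a polynomial
  -- identity.
  obtain ⟨m, hm⟩ : ∃ m, n / 2 = m + 1 :=
    ⟨n / 2 - 1, by have := (half_neZero hn).pos; omega⟩
  have hn' := two_mul_half hn
  rw [hm] at hn'
  rw [sum_eq, DihedralGroup.nat_card]
  simp only [dim, Finset.sum_const, Finset.card_univ, Fintype.card_prod, Fintype.card_fin,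
    card_halfRange, smul_eq_mul, hm, Nat.add_sub_cancel]
  rw [← hn']
  ring

/-! ### The classification -/

theorem sum_dim_sq_eq_finrank (hn : Even n) :
    ∑ ℓ : IrrepLabel n, ℓ.dim ^ 2 = Module.finrank ℂ (QuantumDouble (DihedralGroup n)) :=
  (sum_dim_sq hn).trans QuantumDouble.finrank_eq.symm

theorem exists_equiv_toRep (hn : Even n) (V : Type*) [AddCommGroup V]
    [Module (QuantumDouble (DihedralGroup n)) V]
    (hV : IsSimpleModule (QuantumDouble (DihedralGroup n)) V) :
    ∃ ℓ : IrrepLabel n,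
      Nonempty (V ≃ₗ[QuantumDouble (DihedralGroup n)] RepModule (ℓ.toRep hn)) :=
  RepModule.exists_equiv_of_isSimpleModule (isSimpleModule_toRep hn)
    (fun ℓ ℓ' ⟨e⟩ => eq_of_equiv hn ℓ ℓ' e) (sum_dim_sq_eq_finrank hn) V

theorem exists_isInducedFrom_toRep (hn : Even n) (ℓ : IrrepLabel n) :
    ∃ (q : ℕ) (π : Representation ℂ
        (Subgroup.centralizer {ℓ.cls.rep} : Subgroup (DihedralGroup n)) (Fin q → ℂ)),
      π.IsIrreducible ∧ IsInducedFrom (ℓ.toRep hn) ℓ.cls.rep ℓ.cls.elem ℓ.cls.alpha π := by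
  refine QuantumDouble.exists_isInducedFrom (ℓ.toRep hn) ℓ.cls.rep (isSimpleModule_toRep hn ℓ)
    ℓ.cls.elem_eq_conj (ℓ.cls.elem_injective hn) (ℓ.cls.range_elem hn) fun h hh => ?_
  rw [toRep_dual, Matrix.diagonal_eq_zero]
  funext j
  refine if_neg fun hj => hh ?_
  rw [hj]
  exact ℓ.isConj_rep_deg hn j

end

end IrrepLabel

end DihedralDouble

theorem mainTheorem1 (n : ℕ) [NeZero n] (hn : Even n) :
    -- the table: conjugacy classes, representatives, centralisers and the elements `α_s`
    (Function.Bijective fun c : DihedralDouble.ClassLabel n => ConjClasses.mk c.rep) ∧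
    (∀ c : DihedralDouble.ClassLabel n,
      Function.Injective c.elem ∧
      Set.range c.elem = {g | IsConj c.rep g} ∧
      ((Subgroup.centralizer {c.rep} : Subgroup (DihedralGroup n)) : Set (DihedralGroup n)) =
        c.centraliser ∧
      (∀ i, c.elem i = c.alpha i * c.rep * (c.alpha i)⁻¹) ∧
      (∀ i, c.elem i = c.rep → c.alpha i = 1)) ∧
    -- the irreducible representations
    (∃ ρ : ∀ ℓ : DihedralDouble.IrrepLabel n,
        QuantumDouble (DihedralGroup n) →ₐ[ℂ] Matrix (Fin ℓ.dim) (Fin ℓ.dim) ℂ,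
      (∀ ℓ, ρ ℓ (QuantumDouble.of (DihedralDouble.σ n)) = ℓ.sigmaMat ∧
        ρ ℓ (QuantumDouble.of (DihedralDouble.τ n)) = ℓ.tauMat ∧
        ∀ g, ρ ℓ (QuantumDouble.dual g) = ℓ.dualMat g) ∧
      (∀ ℓ, IsSimpleModule (QuantumDouble (DihedralGroup n)) (RepModule (ρ ℓ))) ∧
      (∀ ℓ ℓ', Nonempty
        (RepModule (ρ ℓ) ≃ₗ[QuantumDouble (DihedralGroup n)] RepModule (ρ ℓ')) → ℓ = ℓ') ∧
      (∀ (V : Type*) [AddCommGroup V] [Module (QuantumDouble (DihedralGroup n)) V],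
        IsSimpleModule (QuantumDouble (DihedralGroup n)) V →
          ∃ ℓ, Nonempty (V ≃ₗ[QuantumDouble (DihedralGroup n)] RepModule (ρ ℓ))) ∧
      -- each one is induced by its conjugacy class
      (∀ ℓ, ∃ (q : ℕ)
        (π : Representation ℂ
          (Subgroup.centralizer {ℓ.cls.rep} : Subgroup (DihedralGroup n)) (Fin q → ℂ)),
        π.IsIrreducible ∧ IsInducedFrom (ρ ℓ) ℓ.cls.rep ℓ.cls.elem ℓ.cls.alpha π)) ∧
    -- the numbers of irreducible representations
    (∀ d : ℕ, numIrreps (QuantumDouble (DihedralGroup n)) d =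
      (if d = 1 then 8 else 0) + (if d = n / 2 then 8 else 0) +
        (if d = 2 then (n + 2) * (n / 2 - 1) else 0)) ∧
    Nat.card {ℓ : DihedralDouble.IrrepLabel n // ℓ.cls = .reflEven} = 4 ∧
    Nat.card {ℓ : DihedralDouble.IrrepLabel n // ℓ.cls = .reflOdd} = 4 ∧
    -- the sum of the squares of the dimensions
    ∑ ℓ : DihedralDouble.IrrepLabel n, ℓ.dim ^ 2 = Nat.card (DihedralGroup n) ^ 2 ∧
    Module.finrank ℂ (QuantumDouble (DihedralGroup n)) = Nat.card (DihedralGroup n) ^ 2 := by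
  refine ⟨DihedralDouble.ClassLabel.bijective_mk_rep hn, fun c =>
    ⟨c.elem_injective hn, c.range_elem hn, c.centralizer_rep hn, c.elem_eq_conj,
      c.alpha_eq_one hn⟩,
    ⟨fun ℓ => ℓ.toRep hn, fun ℓ => ⟨ℓ.toRep_of_σ hn, ℓ.toRep_of_τ hn, fun g => ?_⟩,
      DihedralDouble.IrrepLabel.isSimpleModule_toRep hn,
      fun ℓ ℓ' ⟨e⟩ => DihedralDouble.IrrepLabel.eq_of_equiv hn ℓ ℓ' e,
      fun V _ _ hV => DihedralDouble.IrrepLabel.exists_equiv_toRep hn V hV,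
      DihedralDouble.IrrepLabel.exists_isInducedFrom_toRep hn⟩,
    fun d => ?_, DihedralDouble.IrrepLabel.card_cls_reflEven,
    DihedralDouble.IrrepLabel.card_cls_reflOdd, DihedralDouble.IrrepLabel.sum_dim_sq hn,
    QuantumDouble.finrank_eq⟩
  · rw [ℓ.toRep_dual hn, ℓ.dualMat_eq hn]
  · rw [RepModule.numIrreps_eq_card (DihedralDouble.IrrepLabel.isSimpleModule_toRep hn)
      (fun ℓ ℓ' ⟨e⟩ => DihedralDouble.IrrepLabel.eq_of_equiv hn ℓ ℓ' e)
      (fun V _ _ hV => DihedralDouble.IrrepLabel.exists_equiv_toRep hn V hV),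
      DihedralDouble.IrrepLabel.card_dim_eq]
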